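/- Let $G\rightrightarrows M$ be a Lie groupoid: $M$ (objects) and $G$ (arrows) are finite-dimensional, Hausdorff, second countable smooth manifolds without boundary, the source and target $s,t:G\to M$ are submersions, and the multiplication (on the submanifold of pairs $(g_2,g_1)$ with $s(g_2)=t(g_1)$), the unit map and the inverse map are smooth and satisfy the usual groupoid axioms. Let $\rho=(t,s):G\to M\times M$ be the anchor. For $x,y\in M$ let $G(y,x)=\{h\in G: t(h)=y,\ s(h)=x\}$, an embedded submanifold of $G$, and let $O=\{t(h): h\in G,\ s(h)=x\}$ be the orbit of $x$, an (initial, possibly not embedded) submanifold of $M$; for $z\in O$ let $N_zO=T_zM/T_zO$. For an arrow $g$ from $x$ to $y$ (that is, $s(g)=x$ and $t(g)=y$), the normal representation $\eta_g:N_xO\to N_yO$ is the linear map defined as follows. Put $G_O=s^{-1}(O)=t^{-1}(O)$ and $N_gG_O=T_gG/T_gG_O$. The differential $d_gs$ induces an isomorphism $\bar s:N_gG_O\to N_xO$, the differential $d_gt$ induces a linear map $\bar t:N_gG_O\to N_yO$, and $\eta_g=\bar t\circ\bar s^{-1}$; equivalently, $\eta_g[d_gs(u)]=[d_gt(u)]$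 for all $u\in T_gG$. Then for every arrow $g$ from $x$ to $y$, the differential $d_g\rho:T_gG\to T_yM\times T_xM$ has kernel and image $$\ker(d_g\rho)=T_gG(y,x),\qquad \operatorname{im}(d_g\rho)=\{(v,w)\in T_yM\times T_xM:\ [v]=\eta_g[w]\ \text{in } N_yO\}.$$ -/

import Mathlib

open Set Manifold
open scoped ContDiff Topology

/-- The tangent space at `p` of a submanifold `S` of a manifold `N`, as a subspace of `T_p N`: it
consists of the velocities at `p` of the smooth curves of `N` that stay in `S`. This is the usual
tangent space whenever `S` is an embedded submanifold, or more generally an initial submanifold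
(a smooth map into `N` with image in `S` is smooth as a map into `S`), such as an orbit of a Lie
groupoid. For such `S` the velocities already form a linear subspace, and the span adds nothing. -/
noncomputable def submanifoldTangentSpace {E : Type*} [NormedAddCommGroup E] [NormedSpace ℝ E]
    {N : Type*} [TopologicalSpace N] [ChartedSpace E N] (S : Set N) (p : N) :
    Submodule ℝ (TangentSpace 𝓘(ℝ, E) p) :=
  Submodule.span ℝ {v | ∃ (γ : ℝ → N) (ε : ℝ), 0 < ε ∧
    ContMDiffOn 𝓘(ℝ, ℝ) 𝓘(ℝ, E) ∞ γ (Ioo (-ε) ε) ∧ (∀ r ∈ Ioo (-ε) ε, γ r ∈ S) ∧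
    tangentMap 𝓘(ℝ, ℝ) 𝓘(ℝ, E) γ ⟨0, (1 : ℝ)⟩ = (⟨p, v⟩ : TangentBundle 𝓘(ℝ, E) N)}

/-- A Lie groupoid `G ⇉ M` with manifold of objects `M` and manifold of arrows `G`.
An arrow `g` goes from `s g` to `t g`, and `mul g₂ g₁` is the composite `g₂ g₁`; it is meaningful
only when `s g₂ = t g₁`, and nothing is required of its values on other pairs. -/
structure LieGroupoid (EM : Type*) [NormedAddCommGroup EM] [NormedSpace ℝ EM]
    (M : Type*) [TopologicalSpace M] [ChartedSpace EM M]
    (EG : Type*) [NormedAddCommGroup EG] [NormedSpace ℝ EG]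
    (G : Type*) [TopologicalSpace G] [ChartedSpace EG G] where
  /-- source -/
  s : G → M
  /-- target -/
  t : G → M
  /-- multiplication of composable arrows -/
  mul : G → G → G
  /-- unit -/
  one : M → G
  /-- inverse -/
  inv : G → G
  isSubmersion_s : IsSubmersion 𝓘(ℝ, EG) 𝓘(ℝ, EM) ∞ s
  isSubmersion_t : IsSubmersion 𝓘(ℝ, EG) 𝓘(ℝ, EM) ∞ t
  /-- `mul` is smooth on the submanifold of composable pairs -/
  contMDiffOn_mul : ContMDiffOn (𝓘(ℝ, EG).prod 𝓘(ℝ, EG)) 𝓘(ℝ, EG) ∞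
    (fun p : G × G ↦ mul p.1 p.2) {p | s p.1 = t p.2}
  contMDiff_one : ContMDiff 𝓘(ℝ, EM) 𝓘(ℝ, EG) ∞ one
  contMDiff_inv : ContMDiff 𝓘(ℝ, EG) 𝓘(ℝ, EG) ∞ inv
  s_mul : ∀ g h, s g = t h → s (mul g h) = s h
  t_mul : ∀ g h, s g = t h → t (mul g h) = t g
  mul_assoc : ∀ g h k, s g = t h → s h = t k → mul (mul g h) k = mul g (mul h k)
  s_one : ∀ x, s (one x) = x
  t_one : ∀ x, t (one x) = x
  mul_one : ∀ g, mul g (one (s g)) = g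
  one_mul : ∀ g, mul (one (t g)) g = g
  s_inv : ∀ g, s (inv g) = t g
  t_inv : ∀ g, t (inv g) = s g
  mul_inv : ∀ g, mul g (inv g) = one (t g)
  inv_mul : ∀ g, mul (inv g) g = one (s g)

/-! ### Helper facts on curves and submersions -/

section Helpers

variable {E : Type*} [NormedAddCommGroup E] [NormedSpace ℝ E]
  {N : Type*} [TopologicalSpace N] [ChartedSpace E N]
  {E' : Type*} [NormedAddCommGroup E'] [NormedSpace ℝ E']
  {N' : Type*} [TopologicalSpace N'] [ChartedSpace E' N']

/-- Two tangent vectors at the same point that agree in the tangent bundle are equal. -/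
theorem tangentVector_ext {p : N} {v w : TangentSpace 𝓘(ℝ, E) p}
    (h : (⟨p, v⟩ : TangentBundle 𝓘(ℝ, E) N) = ⟨p, w⟩) : v = w := by
  cases h; rfl

/-- A smooth map carrying `S` into `S'` carries the tangent space of `S` into that of `S'`. -/
theorem mfderiv_mem_submanifoldTangentSpace {f : N → N'}
    (hf : ContMDiff 𝓘(ℝ, E) 𝓘(ℝ, E') ∞ f) {S : Set N} {S' : Set N'} (hS : ∀ q ∈ S, f q ∈ S')
    (p : N) : submanifoldTangentSpace (E := E) S p ≤
      (submanifoldTangentSpace (E := E') S' (f p)).comap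
        (mfderiv 𝓘(ℝ, E) 𝓘(ℝ, E') f p).toLinearMap := by
  refine Submodule.span_le.2 ?_
  rintro v ⟨γ, ε, hε, hγ, hγS, hv⟩
  refine Submodule.subset_span ⟨f ∘ γ, ε, hε, hf.comp_contMDiffOn hγ,
    fun r hr ↦ hS _ (hγS r hr), ?_⟩
  have h0 : MDifferentiableAt 𝓘(ℝ, ℝ) 𝓘(ℝ, E) γ 0 :=
    (hγ.contMDiffAt (Ioo_mem_nhds (by linarith) hε)).mdifferentiableAt (by simp)
  have h1 : MDifferentiableAt 𝓘(ℝ, E) 𝓘(ℝ, E') f (γ 0) := hf.mdifferentiable (by simp) _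
  rw [tangentMap_comp_at (I' := 𝓘(ℝ, E)) (p := ⟨0, (1 : ℝ)⟩) h1 h0, hv]
  rfl

/-- A submersion has a smooth local section through every point. -/
theorem exists_localSection [IsManifold 𝓘(ℝ, E) ∞ N] [IsManifold 𝓘(ℝ, E') ∞ N'] {f : N → N'}
    (hf : IsSubmersion 𝓘(ℝ, E) 𝓘(ℝ, E') ∞ f) (p : N) :
    ∃ (U : Set N') (σ : N' → N), IsOpen U ∧ f p ∈ U ∧
      ContMDiffOn 𝓘(ℝ, E') 𝓘(ℝ, E) ∞ σ U ∧ σ (f p) = p ∧ ∀ z ∈ U, f (σ z) = z := by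
  obtain ⟨F, _, _, hF⟩ := hf
  obtain ⟨φ, ψ, hp, hfp, hφ, hψ, hsub, e, he⟩ := hF p
  have he' : ∀ y ∈ φ.target, ψ (f (φ.symm y)) = (e y).1 := by
    intro y hy
    have := he (x := y) (by simpa using hy)
    simpa using this
  let q : N' → E := fun z ↦ e.symm (ψ z, (e (φ p)).2)
  have hψf : ψ (f p) = (e (φ p)).1 := by
    have := he' (φ p) (φ.map_source hp)
    rwa [φ.left_inv hp] at this
  have hq0 : q (f p) = φ p := by simp [q, hψf]
  have hqs : ContMDiffOn 𝓘(ℝ, E') 𝓘(ℝ, E) ∞ q ψ.source := by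
    have h1 := contMDiffOn_of_mem_maximalAtlas (I := 𝓘(ℝ, E')) (n := ∞) hψ
    have h2 : ContDiff ℝ ∞ (fun y : E' ↦ e.symm (y, (e (φ p)).2)) := by fun_prop
    exact h2.contMDiff.comp_contMDiffOn h1
  have hopen : IsOpen (ψ.source ∩ q ⁻¹' φ.target) :=
    hqs.continuousOn.isOpen_inter_preimage ψ.open_source φ.open_target
  refine ⟨ψ.source ∩ q ⁻¹' φ.target, fun z ↦ φ.symm (q z), hopen,
    ⟨hfp, by simpa [hq0] using φ.map_source hp⟩, ?_, ?_, ?_⟩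
  · exact (contMDiffOn_symm_of_mem_maximalAtlas (I := 𝓘(ℝ, E)) (n := ∞) hφ).comp
      (hqs.mono inter_subset_left) (fun z hz ↦ hz.2)
  · simp [hq0, φ.left_inv hp]
  · rintro z ⟨hz, hz'⟩
    refine ψ.injOn (hsub (φ.map_target hz')) hz ?_
    rw [he' _ hz']
    simp [q]

/-- The differential of a submersion is surjective. -/
theorem mfderiv_surjective_of_isSubmersion [IsManifold 𝓘(ℝ, E) ∞ N] [IsManifold 𝓘(ℝ, E') ∞ N']
    {f : N → N'} (hf : IsSubmersion 𝓘(ℝ, E) 𝓘(ℝ, E') ∞ f) (p : N) :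
    Function.Surjective (mfderiv 𝓘(ℝ, E) 𝓘(ℝ, E') f p) := by
  obtain ⟨U, σ, hU, hpU, hσ, hσp, hfσ⟩ := exists_localSection hf p
  intro w
  have hs : MDifferentiableAt 𝓘(ℝ, E') 𝓘(ℝ, E) σ (f p) :=
    (hσ.contMDiffAt (hU.mem_nhds hpU)).mdifferentiableAt (by simp)
  have hfd : MDifferentiableAt 𝓘(ℝ, E) 𝓘(ℝ, E') f (σ (f p)) :=
    hf.contMDiff.mdifferentiable (by simp) _
  have h1 : HasMFDerivAt 𝓘(ℝ, E') 𝓘(ℝ, E') (f ∘ σ) (f p) _ :=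
    hfd.hasMFDerivAt.comp (f p) hs.hasMFDerivAt
  have h2 : HasMFDerivAt 𝓘(ℝ, E') 𝓘(ℝ, E') (f ∘ σ) (f p) (ContinuousLinearMap.id ℝ _) :=
    (hasMFDerivAt_id (f p)).congr_of_eventuallyEq
      (Filter.eventually_of_mem (hU.mem_nhds hpU) fun z hz ↦ hfσ z hz)
  have h3 := hasMFDerivAt_unique h1 h2
  rw [hσp] at h3
  exact ⟨_, DFunLike.congr_fun h3 w⟩

/-- Vectors killed by the differential of a submersion `f` are velocities of curves along which `f`
is constant. -/
theorem ker_le_submanifoldTangentSpace_preimage [IsManifold 𝓘(ℝ, E) ∞ N]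
    [IsManifold 𝓘(ℝ, E') ∞ N'] {f : N → N'}
    (hf : IsSubmersion 𝓘(ℝ, E) 𝓘(ℝ, E') ∞ f) {S : Set N'} {p : N} (hp : f p ∈ S)
    {u : TangentSpace 𝓘(ℝ, E) p} (hu : mfderiv 𝓘(ℝ, E) 𝓘(ℝ, E') f p u = 0) :
    u ∈ submanifoldTangentSpace (E := E) (f ⁻¹' S) p := by
  have hfs := hf.contMDiff
  obtain ⟨F, _, _, hF⟩ := hf
  obtain ⟨φ, ψ, hpφ, hfp, hφ, hψ, hsub, e, he⟩ := hF p
  have he' : ∀ y ∈ φ.target, ψ (f (φ.symm y)) = (e y).1 := by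
    intro y hy
    have := he (x := y) (by simpa using hy)
    simpa using this
  have dφ : MDifferentiableAt 𝓘(ℝ, E) 𝓘(ℝ, E) φ p :=
    ((contMDiffOn_of_mem_maximalAtlas (I := 𝓘(ℝ, E)) (n := ∞) hφ).contMDiffAt
      (φ.open_source.mem_nhds hpφ)).mdifferentiableAt (by simp)
  have sφ := contMDiffOn_symm_of_mem_maximalAtlas (I := 𝓘(ℝ, E)) (n := ∞) hφ
  have dφs : MDifferentiableAt 𝓘(ℝ, E) 𝓘(ℝ, E) φ.symm (φ p) :=
    (sφ.contMDiffAt (φ.open_target.mem_nhds (φ.map_source hpφ))).mdifferentiableAt (by simp)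
  have dψ : MDifferentiableAt 𝓘(ℝ, E') 𝓘(ℝ, E') ψ (f p) :=
    ((contMDiffOn_of_mem_maximalAtlas (I := 𝓘(ℝ, E')) (n := ∞) hψ).contMDiffAt
      (ψ.open_source.mem_nhds hfp)).mdifferentiableAt (by simp)
  have df : MDifferentiableAt 𝓘(ℝ, E) 𝓘(ℝ, E') f p := hfs.mdifferentiable (by simp) _
  let a : E := mfderiv 𝓘(ℝ, E) 𝓘(ℝ, E) φ p u
  -- in the charts the first component of `a` vanishes
  have hea : (e a).1 = 0 := by
    have h1 : HasMFDerivAt 𝓘(ℝ, E) 𝓘(ℝ, E') (ψ ∘ f) p _ :=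
      dψ.hasMFDerivAt.comp p df.hasMFDerivAt
    have hL : HasMFDerivAt 𝓘(ℝ, E) 𝓘(ℝ, E') (fun y : E ↦ (e y).1) (φ p)
        ((ContinuousLinearMap.fst ℝ E' F).comp (e : E →L[ℝ] E' × F)) :=
      ((ContinuousLinearMap.fst ℝ E' F).comp (e : E →L[ℝ] E' × F)).hasFDerivAt.hasMFDerivAt
    have h2 : HasMFDerivAt 𝓘(ℝ, E) 𝓘(ℝ, E') ((fun y : E ↦ (e y).1) ∘ φ) p _ :=
      hL.comp p dφ.hasMFDerivAt
    have h3 : ψ ∘ f =ᶠ[𝓝 p] (fun y : E ↦ (e y).1) ∘ φ := by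
      filter_upwards [φ.open_source.mem_nhds hpφ] with z hz
      have := he' (φ z) (φ.map_source hz)
      rw [φ.left_inv hz] at this
      exact this
    have h4 := DFunLike.congr_fun (hasMFDerivAt_unique (h2.congr_of_eventuallyEq h3) h1) u
    have h5 : (e a).1 = mfderiv 𝓘(ℝ, E') 𝓘(ℝ, E') ψ (f p) (mfderiv 𝓘(ℝ, E) 𝓘(ℝ, E') f p u) := h4
    rw [h5, hu]
    exact map_zero _
  let c : ℝ → E := fun r ↦ φ p + r • a
  have hc : ContDiff ℝ ∞ c := by fun_prop
  obtain ⟨ε, hε, hball⟩ : ∃ ε > 0, Ioo (-ε) ε ⊆ c ⁻¹' φ.target := by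
    have : c ⁻¹' φ.target ∈ 𝓝 (0 : ℝ) :=
      hc.continuous.continuousAt.preimage_mem_nhds
        (φ.open_target.mem_nhds (by simpa [c] using φ.map_source hpφ))
    obtain ⟨ε, hε, h⟩ := Metric.mem_nhds_iff.1 this
    refine ⟨ε, hε, ?_⟩
    rwa [Real.ball_eq_Ioo, zero_sub, zero_add] at h
  have hc0 : c 0 = φ p := by simp [c]
  refine Submodule.subset_span ⟨φ.symm ∘ c, ε, hε, sφ.comp hc.contMDiff.contMDiffOn hball, ?_, ?_⟩
  · intro r hr
    have hr' : c r ∈ φ.target := hball hr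
    have : f (φ.symm (c r)) = f p := by
      refine ψ.injOn (hsub (φ.map_target hr')) hfp ?_
      have h0 := he' (φ p) (φ.map_source hpφ)
      rw [φ.left_inv hpφ] at h0
      rw [he' _ hr', h0]
      simp [c, hea]
    change f (φ.symm (c r)) ∈ S
    rwa [this]
  · have hcd : HasMFDerivAt 𝓘(ℝ, ℝ) 𝓘(ℝ, E) c 0 ((1 : ℝ →L[ℝ] ℝ).smulRight a) := by
      have h : HasDerivAt c a 0 := by
        simpa [c] using ((hasDerivAt_id (0 : ℝ)).smul_const a).const_add (φ p)
      exact h.hasFDerivAt.hasMFDerivAt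
    have dφs' : MDifferentiableAt 𝓘(ℝ, E) 𝓘(ℝ, E) φ.symm (c 0) := by rwa [hc0]
    rw [tangentMap_comp_at (I' := 𝓘(ℝ, E)) (p := ⟨0, (1 : ℝ)⟩) dφs' hcd.mdifferentiableAt]
    have h1 : tangentMap 𝓘(ℝ, ℝ) 𝓘(ℝ, E) c ⟨0, (1 : ℝ)⟩ =
        tangentMap 𝓘(ℝ, E) 𝓘(ℝ, E) φ ⟨p, u⟩ := by
      have : mfderiv 𝓘(ℝ, ℝ) 𝓘(ℝ, E) c 0 (1 : ℝ) = a := by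
        rw [hcd.mfderiv]
        exact one_smul ℝ a
      unfold tangentMap
      dsimp only
      rw [this, hc0]
    rw [h1, ← tangentMap_comp_at (I' := 𝓘(ℝ, E)) (p := ⟨p, u⟩) dφs dφ]
    have h2 : HasMFDerivAt 𝓘(ℝ, E) 𝓘(ℝ, E) (φ.symm ∘ φ) p (ContinuousLinearMap.id ℝ _) :=
      (hasMFDerivAt_id p).congr_of_eventuallyEq
        (Filter.eventually_of_mem (φ.open_source.mem_nhds hpφ) fun z hz ↦ φ.left_inv hz)
    unfold tangentMap
    dsimp only
    rw [h2.mfderiv]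
    simp only [Function.comp_apply]
    rw [φ.left_inv hpφ]
    rfl

/-- The preimage of `S` under a submersion `f` has all of `(df)⁻¹(TS)` in its tangent space. -/
theorem comap_le_submanifoldTangentSpace_preimage [IsManifold 𝓘(ℝ, E) ∞ N]
    [IsManifold 𝓘(ℝ, E') ∞ N'] {f : N → N'}
    (hf : IsSubmersion 𝓘(ℝ, E) 𝓘(ℝ, E') ∞ f) {S : Set N'} {p : N} (hp : f p ∈ S) :
    (submanifoldTangentSpace (E := E') S (f p)).comap
        (mfderiv 𝓘(ℝ, E) 𝓘(ℝ, E') f p).toLinearMap ≤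
      submanifoldTangentSpace (E := E) (f ⁻¹' S) p := by
  obtain ⟨U, σ, hU, hpU, hσ, hσp, hfσ⟩ := exists_localSection hf p
  -- velocities of curves in `S` lift to velocities of curves in the preimage
  have hlift : submanifoldTangentSpace (E := E') S (f p) ≤
      (submanifoldTangentSpace (E := E) (f ⁻¹' S) p).map
        (mfderiv 𝓘(ℝ, E) 𝓘(ℝ, E') f p).toLinearMap := by
    refine Submodule.span_le.2 ?_
    rintro w ⟨γ, ε, hε, hγ, hγS, hw⟩
    have hγ0 : γ 0 = f p := congrArg Bundle.TotalSpace.proj hw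
    have hγc : ContMDiffAt 𝓘(ℝ, ℝ) 𝓘(ℝ, E') ∞ γ 0 :=
      hγ.contMDiffAt (Ioo_mem_nhds (by linarith) hε)
    have hγd : MDifferentiableAt 𝓘(ℝ, ℝ) 𝓘(ℝ, E') γ 0 := hγc.mdifferentiableAt (by simp)
    obtain ⟨δ, hδ, hball⟩ : ∃ δ > 0, Ioo (-δ) δ ⊆ Ioo (-ε) ε ∩ γ ⁻¹' U := by
      have : Ioo (-ε) ε ∩ γ ⁻¹' U ∈ 𝓝 (0 : ℝ) :=
        Filter.inter_mem (Ioo_mem_nhds (by linarith) hε)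
          (hγc.continuousAt.preimage_mem_nhds (hU.mem_nhds (by rwa [hγ0])))
      obtain ⟨δ, hδ, h⟩ := Metric.mem_nhds_iff.1 this
      refine ⟨δ, hδ, ?_⟩
      rwa [Real.ball_eq_Ioo, zero_sub, zero_add] at h
    have hσγ : ContMDiffOn 𝓘(ℝ, ℝ) 𝓘(ℝ, E) ∞ (σ ∘ γ) (Ioo (-δ) δ) :=
      hσ.comp (hγ.mono fun r hr ↦ (hball hr).1) (fun r hr ↦ (hball hr).2)
    have hσγd : MDifferentiableAt 𝓘(ℝ, ℝ) 𝓘(ℝ, E) (σ ∘ γ) 0 :=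
      (hσγ.contMDiffAt (Ioo_mem_nhds (by linarith) hδ)).mdifferentiableAt (by simp)
    have h0 : (σ ∘ γ) 0 = p := by simp [hγ0, hσp]
    obtain ⟨u, hu⟩ : ∃ u : TangentSpace 𝓘(ℝ, E) p,
        tangentMap 𝓘(ℝ, ℝ) 𝓘(ℝ, E) (σ ∘ γ) ⟨0, (1 : ℝ)⟩ = ⟨p, u⟩ := by
      unfold tangentMap
      dsimp only
      rw [h0]
      exact ⟨_, rfl⟩
    refine ⟨u, Submodule.subset_span ⟨σ ∘ γ, δ, hδ, hσγ, ?_, hu⟩, ?_⟩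
    · intro r hr
      change f (σ (γ r)) ∈ S
      rw [hfσ _ (hball hr).2]
      exact hγS r (hball hr).1
    · refine tangentVector_ext (N := N') ?_
      have hfd : MDifferentiableAt 𝓘(ℝ, E) 𝓘(ℝ, E') f ((σ ∘ γ) 0) :=
        hf.contMDiff.mdifferentiable (by simp) _
      have h1 := tangentMap_comp_at (I' := 𝓘(ℝ, E)) (p := ⟨0, (1 : ℝ)⟩) hfd hσγd
      rw [hu] at h1
      have h2 : f ∘ (σ ∘ γ) =ᶠ[𝓝 0] γ :=
        Filter.eventually_of_mem (Ioo_mem_nhds (by linarith) hδ) fun r hr ↦ hfσ _ (hball hr).2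
      have h3 : tangentMap 𝓘(ℝ, ℝ) 𝓘(ℝ, E') (f ∘ (σ ∘ γ)) ⟨0, (1 : ℝ)⟩ =
          tangentMap 𝓘(ℝ, ℝ) 𝓘(ℝ, E') γ ⟨0, (1 : ℝ)⟩ := by
        unfold tangentMap
        dsimp only
        rw [h2.mfderiv_eq, h2.eq_of_nhds]
      rw [← hw, ← h3, h1]
      rfl
  intro u hu
  obtain ⟨u', hu', huu'⟩ := hlift hu
  have hk := ker_le_submanifoldTangentSpace_preimage hf (S := S) hp (u := u - u') (by
    have : mfderiv 𝓘(ℝ, E) 𝓘(ℝ, E') f p u' = mfderiv 𝓘(ℝ, E) 𝓘(ℝ, E') f p u := huu'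
    rw [map_sub, this, sub_self])
  simpa using Submodule.add_mem _ hk hu'

end Helpers

namespace LieGroupoid

variable {EM : Type*} [NormedAddCommGroup EM] [NormedSpace ℝ EM]
  {M : Type*} [TopologicalSpace M] [ChartedSpace EM M]
  {EG : Type*} [NormedAddCommGroup EG] [NormedSpace ℝ EG]
  {G : Type*} [TopologicalSpace G] [ChartedSpace EG G]

/-- The set `G(y, x)` of arrows from `x` to `y`. -/
def arrows (𝒢 : LieGroupoid EM M EG G) (y x : M) : Set G := {g | 𝒢.t g = y ∧ 𝒢.s g = x}

/-- The orbit `O_x` of `x`. -/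
def orbit (𝒢 : LieGroupoid EM M EG G) (x : M) : Set M := {y | ∃ g, 𝒢.s g = x ∧ 𝒢.t g = y}

/-- The anchor `ρ = (t, s) : G → M × M`. -/
def anchor (𝒢 : LieGroupoid EM M EG G) (g : G) : M × M := (𝒢.t g, 𝒢.s g)

/-- The tangent space `T_x O` at `x` of the orbit `O` of `x`. -/
noncomputable def orbitTangentSpace (𝒢 : LieGroupoid EM M EG G) (x : M) :
    Submodule ℝ (TangentSpace 𝓘(ℝ, EM) x) :=
  submanifoldTangentSpace (𝒢.orbit x) x

/-- The normal space `N_x O = T_x M / T_x O` at `x` to the orbit `O` of `x`. -/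
abbrev NormalSpace (𝒢 : LieGroupoid EM M EG G) (x : M) : Type _ :=
  TangentSpace 𝓘(ℝ, EM) x ⧸ 𝒢.orbitTangentSpace x

/-- The tangent space `T_g G_O` at `g` of the restriction `G_O = s⁻¹(O) = t⁻¹(O)` of the groupoid
to the orbit `O` of `s g`. -/
noncomputable def restrictionTangentSpace (𝒢 : LieGroupoid EM M EG G) (g : G) :
    Submodule ℝ (TangentSpace 𝓘(ℝ, EG) g) :=
  submanifoldTangentSpace (𝒢.s ⁻¹' 𝒢.orbit (𝒢.s g)) g

/-- The normal space `N_g G_O = T_g G / T_g G_O`. -/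
abbrev RestrictionNormalSpace (𝒢 : LieGroupoid EM M EG G) (g : G) : Type _ :=
  TangentSpace 𝓘(ℝ, EG) g ⧸ 𝒢.restrictionTangentSpace g

theorem mem_orbit_self (𝒢 : LieGroupoid EM M EG G) (x : M) : x ∈ 𝒢.orbit x :=
  ⟨𝒢.one x, 𝒢.s_one x, 𝒢.t_one x⟩

theorem t_mem_orbit (𝒢 : LieGroupoid EM M EG G) (g h : G)
    (hh : 𝒢.s h ∈ 𝒢.orbit (𝒢.s g)) : 𝒢.t h ∈ 𝒢.orbit (𝒢.t g) := by
  obtain ⟨k, hk, hk'⟩ := hh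
  have h1 : 𝒢.s k = 𝒢.t (𝒢.inv g) := by rw [hk, 𝒢.t_inv]
  have h2 : 𝒢.s h = 𝒢.t (𝒢.mul k (𝒢.inv g)) := by rw [𝒢.t_mul _ _ h1, hk']
  exact ⟨𝒢.mul h (𝒢.mul k (𝒢.inv g)), by rw [𝒢.s_mul _ _ h2, 𝒢.s_mul _ _ h1, 𝒢.s_inv],
    𝒢.t_mul _ _ h2⟩

/-- The linear map `N_g G_O → N_x O`, `x = s g`, induced by the differential of the source. -/
noncomputable def sourceNormal (𝒢 : LieGroupoid EM M EG G) (g : G) :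
    𝒢.RestrictionNormalSpace g →ₗ[ℝ] 𝒢.NormalSpace (𝒢.s g) :=
  Submodule.mapQ _ _ (mfderiv 𝓘(ℝ, EG) 𝓘(ℝ, EM) 𝒢.s g).toLinearMap
    (mfderiv_mem_submanifoldTangentSpace 𝒢.isSubmersion_s.contMDiff (fun _ h ↦ h) g)

/-- The linear map `N_g G_O → N_y O`, `y = t g`, induced by the differential of the target. -/
noncomputable def targetNormal (𝒢 : LieGroupoid EM M EG G) (g : G) :
    𝒢.RestrictionNormalSpace g →ₗ[ℝ] 𝒢.NormalSpace (𝒢.t g) :=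
  Submodule.mapQ _ _ (mfderiv 𝓘(ℝ, EG) 𝓘(ℝ, EM) 𝒢.t g).toLinearMap
    (mfderiv_mem_submanifoldTangentSpace 𝒢.isSubmersion_t.contMDiff
      (fun h hh ↦ 𝒢.t_mem_orbit g h hh) g)

theorem sourceNormal_bijective [IsManifold 𝓘(ℝ, EM) ∞ M] [IsManifold 𝓘(ℝ, EG) ∞ G]
    (𝒢 : LieGroupoid EM M EG G) (g : G) : Function.Bijective (𝒢.sourceNormal g) := by
  constructor
  · rw [← LinearMap.ker_eq_bot, eq_bot_iff]
    intro a ha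
    obtain ⟨u, rfl⟩ := Submodule.mkQ_surjective _ a
    have hu : mfderiv 𝓘(ℝ, EG) 𝓘(ℝ, EM) 𝒢.s g u ∈ 𝒢.orbitTangentSpace (𝒢.s g) :=
      (Submodule.Quotient.mk_eq_zero _).1 ha
    exact (Submodule.Quotient.mk_eq_zero _).2
      (comap_le_submanifoldTangentSpace_preimage 𝒢.isSubmersion_s (𝒢.mem_orbit_self _) hu)
  · intro b
    obtain ⟨w, rfl⟩ := Submodule.mkQ_surjective _ b
    obtain ⟨u, rfl⟩ := mfderiv_surjective_of_isSubmersion 𝒢.isSubmersion_s g w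
    exact ⟨Submodule.Quotient.mk u, rfl⟩

/-- The normal representation `η_g : N_x O → N_y O` of an arrow `g` from `x` to `y`: the inverse of
the isomorphism `N_g G_O ≅ N_x O` induced by the source, followed by the map `N_g G_O → N_y O`
induced by the target. -/
noncomputable def normalRep [IsManifold 𝓘(ℝ, EM) ∞ M] [IsManifold 𝓘(ℝ, EG) ∞ G]
    (𝒢 : LieGroupoid EM M EG G) (g : G) : 𝒢.NormalSpace (𝒢.s g) →ₗ[ℝ] 𝒢.NormalSpace (𝒢.t g) :=
  𝒢.targetNormal g ∘ₗ
    (LinearEquiv.ofBijective (𝒢.sourceNormal g) (𝒢.sourceNormal_bijective g)).symm.toLinearMap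

/-- `η_g` sends the class of `d_g s (u)` to the class of `d_g t (u)`, for all `u ∈ T_g G`. -/
theorem normalRep_mk [IsManifold 𝓘(ℝ, EM) ∞ M] [IsManifold 𝓘(ℝ, EG) ∞ G]
    (𝒢 : LieGroupoid EM M EG G) (g : G) (u : TangentSpace 𝓘(ℝ, EG) g) :
    𝒢.normalRep g (Submodule.Quotient.mk (mfderiv 𝓘(ℝ, EG) 𝓘(ℝ, EM) 𝒢.s g u)) =
      Submodule.Quotient.mk (mfderiv 𝓘(ℝ, EG) 𝓘(ℝ, EM) 𝒢.t g u) := by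
  have h : (LinearEquiv.ofBijective (𝒢.sourceNormal g) (𝒢.sourceNormal_bijective g)).symm
      (Submodule.Quotient.mk (mfderiv 𝓘(ℝ, EG) 𝓘(ℝ, EM) 𝒢.s g u)) = Submodule.Quotient.mk u :=
    (LinearEquiv.symm_apply_eq _).2 rfl
  exact congrArg (𝒢.targetNormal g) h

end LieGroupoid

/-! Write `D_h` for `dt (ker d_h s)`, the `orbitDirection` at an arrow `h`. Right translation along
source fibres preserves the target, so `D_h` depends only on `t h`. Inversion exchanges `s` and `t`,
and `dt (ker ds)` and `ds (ker dt)` have equal dimension because both submersions have kernels of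
the same dimension; hence `dim D_h` depends only on `s h` (`finrank_orbitDirection_one`). So `t` has
constant rank on each source fibre.

Kernel: if `ds u = 0` and `dt u = 0`, the constant rank theorem applied to `t` on the source fibre
of `g` gives a curve with velocity `u` along which `s` and `t` are both constant
(`mem_submanifoldTangentSpace_arrows`). Conversely, `s` and `t` are constant along any curve in
`G(y, x)`.

Image: a pair `(dt u, ds u)` satisfies the condition by the description of `η_g`. Conversely, choose
`u` with `ds u = w`; then `v - dt u` is tangent to the orbit, and `u` can be corrected by a vector
of `ker d_g s` once `T_y O ≤ D_g` is known (`orbitTangentSpace_le`).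

That inclusion is the hard point, since `T_y O` is spanned by velocities of curves that are smooth
in `M` and merely stay in the orbit as a set: arrows over such a curve can be chosen only without
continuity. As `G` is second countable, the choice accumulates at its own value at all but countably
many times (`countable_setOf_not_frequently`). At those times, which are dense, the curve repeatedly
meets the local image of a constant rank map, so its velocity lies in the direction of the orbit
(`mem_range_fderiv_of_frequently`). At the remaining times this follows by continuity, because the
directions have constant dimension (`mem_range_of_frequently`). -/

/-! ### Constant rank maps, limits of ranges, and accumulation of arbitrary choices. -/

section ConstantRank

variable {F : Type*} [NormedAddCommGroup F] [NormedSpace ℝ F] [FiniteDimensional ℝ F]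
  {E : Type*} [NormedAddCommGroup E] [NormedSpace ℝ E]

/-- The constant rank theorem: near `b₀` a smooth map `f` of constant rank factors through the
projection `P` onto the range of its differential, and the fibres of `P ∘ f` are parametrized by
the kernel of its differential. -/
theorem exists_constantRank_parametrization {f : F → E} {B : Set F} (hB : IsOpen B) {b₀ : F}
    (hb₀ : b₀ ∈ B) (hf : ContDiffOn ℝ ∞ f B)
    (hrank : ∀ b ∈ B, Module.finrank ℝ (fderiv ℝ f b).range =
      Module.finrank ℝ (fderiv ℝ f b₀).range) :
    ∃ (P : E →L[ℝ] (fderiv ℝ f b₀).range) (k₀ : (fderiv ℝ f b₀).ker)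
      (σ : (fderiv ℝ f b₀).range × (fderiv ℝ f b₀).ker → F)
      (σ' : (fderiv ℝ f b₀).range × (fderiv ℝ f b₀).ker →L[ℝ] F)
      (W : Set ((fderiv ℝ f b₀).range × (fderiv ℝ f b₀).ker)),
      IsOpen W ∧ (P (f b₀), k₀) ∈ W ∧ ContDiffOn ℝ ∞ σ W ∧ MapsTo σ W B ∧
      σ (P (f b₀), k₀) = b₀ ∧ HasFDerivAt σ σ' (P (f b₀), k₀) ∧
      (∀ κ : (fderiv ℝ f b₀).ker, σ' (0, κ) = κ) ∧
      (∀ a k, (a, k) ∈ W → f (σ (a, k)) = f (σ (a, k₀))) ∧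
      ∀ᶠ b in 𝓝 b₀, f b = f (σ (P (f b), k₀)) := by
  set A := fderiv ℝ f b₀ with hA
  obtain ⟨P, hP⟩ := Submodule.ClosedComplemented.of_finiteDimensional A.range
  obtain ⟨Q, hQ⟩ := Submodule.ClosedComplemented.of_finiteDimensional A.ker
  have hfd : ∀ b ∈ B, HasFDerivAt f (fderiv ℝ f b) b := fun b hb ↦
    ((hf.contDiffAt (hB.mem_nhds hb)).differentiableAt (by simp)).hasFDerivAt
  -- `Φ` straightens `f`: its differential at `b₀` is invertible because `P` retracts onto the range
  -- of `A` and `Q` onto its kernel. The map `σ` is its local inverse.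
  let Φ : F → A.range × A.ker := fun b ↦ (P (f b), Q b)
  have hΦs : ContDiffOn ℝ ∞ Φ B := by
    exact (P.contDiff.comp_contDiffOn hf).prodMk Q.contDiff.contDiffOn
  have hΦd : ∀ b ∈ B, HasFDerivAt Φ ((P.comp (fderiv ℝ f b)).prod Q) b := fun b hb ↦
    (P.hasFDerivAt.comp b (hfd b hb)).prodMk Q.hasFDerivAt
  have hPA : ∀ u, ((P (A u) : A.range) : E) = A u := fun u ↦
    congrArg Subtype.val (hP ⟨A u, u, rfl⟩)
  have hbij : Function.Bijective ((P.comp A).prod Q) := by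
    constructor
    · refine (injective_iff_map_eq_zero _).2 fun u hu ↦ ?_
      have h1 : P (A u) = 0 := congrArg Prod.fst hu
      have h2 : Q u = 0 := congrArg Prod.snd hu
      have h3 : A u = 0 := by rw [← hPA, h1]; rfl
      have h4 := hQ ⟨u, h3⟩
      rw [h2] at h4
      exact (congrArg Subtype.val h4).symm
    · rintro ⟨⟨_, u, rfl⟩, k⟩
      refine ⟨u - Q u + k, ?_⟩
      have h1 : A (u - Q u + k) = A u := by
        have h2 : A (Q u : F) = 0 := (Q u).2
        have h3 : A (k : F) = 0 := k.2
        rw [map_add, map_sub, h2, h3]; simp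
      refine Prod.ext ?_ ?_
      · change P (A (u - Q u + k)) = _
        rw [h1]
        exact hP ⟨A u, u, rfl⟩
      · change Q (u - Q u + k) = k
        rw [map_add, map_sub, hQ, hQ]; simp
  let A' : F ≃L[ℝ] A.range × A.ker := ContinuousLinearEquiv.ofBijective ((P.comp A).prod Q)
    (LinearMap.ker_eq_bot.2 hbij.1) (LinearMap.range_eq_top.2 hbij.2)
  have hA' : (A' : F →L[ℝ] A.range × A.ker) = (P.comp A).prod Q :=
    ContinuousLinearEquiv.coe_ofBijective _ _ _
  have hΦ0 : ContDiffAt ℝ ∞ Φ b₀ := hΦs.contDiffAt (hB.mem_nhds hb₀)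
  have hΦ0' : HasFDerivAt Φ (A' : F →L[ℝ] A.range × A.ker) b₀ := by
    rw [hA']; exact hΦd b₀ hb₀
  let H := hΦ0.toOpenPartialHomeomorph Φ hΦ0' (by simp)
  have hHs : b₀ ∈ H.source := hΦ0.mem_toOpenPartialHomeomorph_source hΦ0' (by simp)
  have hHΦ : ∀ b, H b = Φ b := fun _ ↦ rfl
  -- the differential of `Φ` stays invertible near `b₀`
  have hinv : ∀ᶠ b in 𝓝 b₀, fderiv ℝ Φ b ∈ range ((↑) : (F ≃L[ℝ] A.range × A.ker) → _) := by
    have hc : ContinuousAt (fderiv ℝ Φ) b₀ := hΦ0.continuousAt_fderiv (by simp)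
    refine hc ?_
    rw [hΦ0'.fderiv]
    exact ContinuousLinearEquiv.nhds A'
  have hev : ∀ᶠ z in 𝓝 (Φ b₀), z ∈ H.target ∧ H.symm z ∈ B ∧
      fderiv ℝ Φ (H.symm z) ∈ range ((↑) : (F ≃L[ℝ] A.range × A.ker) → _) := by
    have ht : Φ b₀ ∈ H.target := H.map_source hHs
    have hcs : Filter.Tendsto H.symm (𝓝 (Φ b₀)) (𝓝 b₀) := by
      have := H.continuousAt_symm ht
      rwa [ContinuousAt, ← hHΦ, H.left_inv hHs] at this
    exact Filter.Eventually.and (H.open_target.mem_nhds ht)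
      (Filter.Eventually.and (hcs (hB.mem_nhds hb₀)) (hcs hinv))
  obtain ⟨δ, hδ, hball⟩ := Metric.eventually_nhds_iff_ball.1 hev
  have hmem : Φ b₀ ∈ Metric.ball (Φ b₀) δ := Metric.mem_ball_self hδ
  have hs0 : H.symm (Φ b₀) = b₀ := H.left_inv hHs
  have hσs : ∀ z ∈ Metric.ball (Φ b₀) δ, ContDiffAt ℝ ∞ H.symm z := by
    intro z hz
    obtain ⟨h1, h2, L, hL⟩ := hball z hz
    refine H.contDiffAt_symm h1 (f₀' := L) ?_ (hΦs.contDiffAt (hB.mem_nhds h2))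
    rw [hL]
    exact (hΦd _ h2).differentiableAt.hasFDerivAt
  have hσ' : HasFDerivAt H.symm (A'.symm : A.range × A.ker →L[ℝ] F) (Φ b₀) := by
    refine H.hasFDerivAt_symm (H.map_source hHs) ?_
    rw [hs0]; exact hΦ0'
  have hright : ∀ z ∈ Metric.ball (Φ b₀) δ, Φ (H.symm z) = z := fun z hz ↦
    H.right_inv (hball z hz).1
  have hconst : ∀ a k, (a, k) ∈ Metric.ball (Φ b₀) δ →
      f (H.symm (a, k)) = f (H.symm (a, Q b₀)) := by
    intro a k hak
    -- For the product metric a ball is a product of balls, so the slice over `a` is a ball in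
    -- `A.ker` centred at `Q b₀`, hence connected.
    rw [show Φ b₀ = (P (f b₀), Q b₀) from rfl, ← ball_prod_same] at hak hσs hball hright
    have hda : ∀ k' ∈ Metric.ball (Q b₀) δ,
        HasFDerivAt (fun k' ↦ f (H.symm (a, k'))) (0 : A.ker →L[ℝ] E) k' := by
      intro k' hk'
      have hz : (a, k') ∈ Metric.ball (P (f b₀)) δ ×ˢ Metric.ball (Q b₀) δ := ⟨hak.1, hk'⟩
      have hb := (hball _ hz).2.1
      have d1 := ((hσs _ hz).differentiableAt (by simp)).hasFDerivAt
      have d2 : HasFDerivAt (f ∘ H.symm) _ (a, k') := (hfd _ hb).comp (a, k') d1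
      have d3 : HasFDerivAt (fun z ↦ P (f (H.symm z))) _ (a, k') := P.hasFDerivAt.comp (a, k') d2
      have d4 : HasFDerivAt (fun z ↦ P (f (H.symm z)))
          (ContinuousLinearMap.fst ℝ A.range A.ker) (a, k') := by
        refine hasFDerivAt_fst.congr_of_eventuallyEq ?_
        filter_upwards [(Metric.isOpen_ball.prod Metric.isOpen_ball).mem_nhds hz] with z hz
        exact congrArg Prod.fst (hright z hz)
      have h5 : ∀ w, P (fderiv ℝ f (H.symm (a, k')) (fderiv ℝ H.symm (a, k') w)) = w.1 :=
        fun w ↦ DFunLike.congr_fun (d3.unique d4) w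
      -- The constant rank is used here: by `h5`, `P` maps the range of `df` at the nearby point
      -- onto `A.range`, and equal dimensions make it injective there. A derivative along the kernel
      -- factor has zero image under `P`, so it vanishes.
      have hPinj : Function.Injective
          (P.toLinearMap.domRestrict (fderiv ℝ f (H.symm (a, k'))).range) := by
        refine (LinearMap.injective_iff_surjective_of_finrank_eq_finrank (hrank _ hb)).2 ?_
        exact fun α ↦ ⟨⟨_, _, rfl⟩, h5 (α, 0)⟩
      have h6 : ∀ κ, fderiv ℝ f (H.symm (a, k')) (fderiv ℝ H.symm (a, k') (0, κ)) = 0 := by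
        intro κ
        have : (⟨_, _, rfl⟩ : (fderiv ℝ f (H.symm (a, k'))).range) = 0 :=
          hPinj ((h5 (0, κ)).trans (map_zero _).symm)
        exact congrArg Subtype.val this
      have d5 := d2.comp k' (hasFDerivAt_prodMk_right a k')
      refine d5.congr_fderiv ?_
      ext κ
      exact h6 κ
    refine Metric.isOpen_ball.is_const_of_fderiv_eq_zero
      (convex_ball (Q b₀) δ).isPreconnected
      (fun k' hk' ↦ (hda k' hk').differentiableAt.differentiableWithinAt)
      (fun k' hk' ↦ (hda k' hk').fderiv) hak.2 (Metric.mem_ball_self hδ)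
  refine ⟨P, Q b₀, H.symm, A'.symm, Metric.ball (Φ b₀) δ, Metric.isOpen_ball, hmem,
    fun z hz ↦ (hσs z hz).contDiffWithinAt, fun z hz ↦ (hball z hz).2.1, hs0, hσ', ?_, hconst, ?_⟩
  · intro κ
    change A'.symm (0, κ) = κ
    rw [ContinuousLinearEquiv.symm_apply_eq]
    have : A' κ = (P (A κ), Q κ) := DFunLike.congr_fun hA' _
    rw [this, hQ, show A (κ : F) = 0 from κ.2, map_zero]
  · filter_upwards [hΦ0.continuousAt (Metric.ball_mem_nhds _ hδ), H.open_source.mem_nhds hHs]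
      with b hb hb'
    have h1 : H.symm (Φ b) = b := H.left_inv hb'
    have h2 := hconst _ _ hb
    rw [← h2]
    exact congrArg f h1.symm

/-- Kernel vectors of a smooth map of constant rank are velocities of smooth curves along which the
map is constant. -/
theorem exists_curve_of_constantRank {f : F → E} {B : Set F} (hB : IsOpen B) {b₀ : F}
    (hb₀ : b₀ ∈ B) (hf : ContDiffOn ℝ ∞ f B)
    (hrank : ∀ b ∈ B, Module.finrank ℝ (fderiv ℝ f b).range =
      Module.finrank ℝ (fderiv ℝ f b₀).range) {β : F} (hβ : fderiv ℝ f b₀ β = 0) :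
    ∃ (c : ℝ → F) (ε : ℝ), 0 < ε ∧ ContDiffOn ℝ ∞ c (Ioo (-ε) ε) ∧ MapsTo c (Ioo (-ε) ε) B ∧
      c 0 = b₀ ∧ HasDerivAt c β 0 ∧ ∀ r ∈ Ioo (-ε) ε, f (c r) = f b₀ := by
  obtain ⟨P, k₀, σ, σ', W, hW, h0W, hσ, hσB, hσ0, hσd, hσ', hconst, -⟩ :=
    exists_constantRank_parametrization hB hb₀ hf hrank
  let κ : (fderiv ℝ f b₀).ker := ⟨β, hβ⟩
  let ℓ : ℝ → (fderiv ℝ f b₀).range × (fderiv ℝ f b₀).ker := fun r ↦ (P (f b₀), k₀ + r • κ)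
  have hℓ : ContDiff ℝ ∞ ℓ := by fun_prop
  have hℓ0 : ℓ 0 = (P (f b₀), k₀) := by simp [ℓ]
  obtain ⟨ε, hε, hball⟩ : ∃ ε > 0, Ioo (-ε) ε ⊆ ℓ ⁻¹' W := by
    have : ℓ ⁻¹' W ∈ 𝓝 (0 : ℝ) :=
      hℓ.continuous.continuousAt.preimage_mem_nhds (hW.mem_nhds (by rwa [hℓ0]))
    obtain ⟨ε, hε, h⟩ := Metric.mem_nhds_iff.1 this
    exact ⟨ε, hε, by rwa [Real.ball_eq_Ioo, zero_sub, zero_add] at h⟩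
  refine ⟨σ ∘ ℓ, ε, hε, hσ.comp hℓ.contDiffOn hball, fun r hr ↦ hσB (hball hr), ?_, ?_, ?_⟩
  · rw [Function.comp_apply, hℓ0, hσ0]
  · have h1 : HasDerivAt ℓ (0, κ) 0 := by
      refine (hasDerivAt_const (0 : ℝ) (P (f b₀))).prodMk ?_
      simpa using ((hasDerivAt_id (0 : ℝ)).smul_const κ).const_add k₀
    rw [← hℓ0] at hσd
    have := hσd.comp_hasDerivAt (0 : ℝ) h1
    rwa [hσ'] at this
  · intro r hr
    have h1 := hconst _ _ (hball hr)
    exact h1.trans (congrArg f hσ0)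

/-- If a curve meets the local image of a map of constant rank at a sequence of times tending to
`r₀`, then its velocity at `r₀` is in the range of the differential of the map. -/
theorem mem_range_fderiv_of_frequently {f : F → E} {B : Set F} (hB : IsOpen B) {b₀ : F}
    (hb₀ : b₀ ∈ B) (hf : ContDiffOn ℝ ∞ f B)
    (hrank : ∀ b ∈ B, Module.finrank ℝ (fderiv ℝ f b).range =
      Module.finrank ℝ (fderiv ℝ f b₀).range) {y : ℝ → E} {v : E} {r₀ : ℝ}
    (hy : HasDerivAt y v r₀) (hy0 : y r₀ = f b₀)
    (hfreq : ∀ V ∈ 𝓝 b₀, ∃ᶠ r in 𝓝[≠] r₀, y r ∈ f '' V) :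
    v ∈ (fderiv ℝ f b₀).range := by
  obtain ⟨P, k₀, σ, σ', W, hW, h0W, hσ, hσB, hσ0, hσd, -, -, hfac⟩ :=
    exists_constantRank_parametrization hB hb₀ hf hrank
  have hfd : HasFDerivAt f (fderiv ℝ f b₀) (σ (P (y r₀), k₀)) := by
    rw [hy0, hσ0]
    exact ((hf.contDiffAt (hB.mem_nhds hb₀)).differentiableAt (by simp)).hasFDerivAt
  rw [← hy0] at hσd
  have h1 : HasDerivAt (fun r ↦ (P (y r), k₀)) (P v, 0) r₀ :=
    (P.hasFDerivAt.comp_hasDerivAt r₀ hy).prodMk (hasDerivAt_const r₀ k₀)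
  have h2 : HasDerivAt (fun r ↦ f (σ (P (y r), k₀))) (fderiv ℝ f b₀ (σ' (P v, 0))) r₀ :=
    hfd.comp_hasDerivAt r₀ (hσd.comp_hasDerivAt r₀ h1)
  have h3 := hy.sub h2
  -- Where `y` meets the local image it equals `f (σ (P y, k₀))`. The difference of these two curves
  -- vanishes at `r₀` and at times accumulating there, so `0` is a frequent value of its slope and
  -- therefore its derivative.
  have hfr : ∃ᶠ r in 𝓝[≠] r₀, slope (y - fun r ↦ f (σ (P (y r), k₀))) r₀ r ∈ ({0} : Set E) := by
    refine (hfreq _ hfac).mono ?_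
    rintro r ⟨b, hb, hbr⟩
    have h4 : y r = f (σ (P (y r), k₀)) := by rw [← hbr]; exact hb
    have h5 : y r₀ = f (σ (P (y r₀), k₀)) := by rw [hy0, hσ0]
    simp [slope, ← h4, ← h5]
  have h6 := isClosed_singleton.mem_of_frequently_of_tendsto hfr
    (hasDerivAt_iff_tendsto_slope.1 h3)
  exact ⟨_, (sub_eq_zero.1 h6).symm⟩

/-- Membership in the range of a continuous family of linear maps passes to a limit at which the
rank does not drop. -/
theorem mem_range_of_frequently {X : Type*} [TopologicalSpace X] {x₀ : X} {L : X → F →L[ℝ] E}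
    {w : X → E} (hL : ContinuousAt L x₀) (hw : ContinuousAt w x₀)
    (h : ∃ᶠ x in 𝓝 x₀, w x ∈ (L x).range ∧
      Module.finrank ℝ (L x).range ≤ Module.finrank ℝ (L x₀).range) :
    w x₀ ∈ (L x₀).range := by
  by_contra hnot
  let b := Module.finBasis ℝ (L x₀).range
  choose u hu using fun i ↦ (b i).2
  -- If `w x₀` lay outside the range, adjoining it to the images `L x₀ (u i)` of a basis would give
  -- an independent family with one element more than the rank. Independence is an open condition,
  -- so it would persist at nearby points, where the rank is too small.
  let fam : X → Option (Fin (Module.finrank ℝ (L x₀).range)) → E := fun x o ↦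
    o.elim (w x) fun i ↦ L x (u i)
  have hfam : ContinuousAt fam x₀ := by
    refine continuousAt_pi.2 fun o ↦ ?_
    cases o with
    | none => exact hw
    | some i => exact hL.clm_apply continuousAt_const
  have hspan : Submodule.span ℝ (range fun i ↦ L x₀ (u i)) ≤ (L x₀).range :=
    Submodule.span_le.2 (by rintro _ ⟨i, rfl⟩; exact ⟨u i, rfl⟩)
  have hli0 : LinearIndependent ℝ (fam x₀) := by
    refine linearIndependent_option.2 ⟨?_, fun hmem ↦ hnot (hspan hmem)⟩
    have h1 := b.linearIndependent.map' (L x₀).range.subtype (Submodule.ker_subtype _)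
    have h2 : fam x₀ ∘ some = (L x₀).range.subtype ∘ b := funext hu
    rwa [← h2] at h1
  obtain ⟨x, ⟨hx, hxk⟩, hli⟩ := (h.and_eventually (hfam.eventually hli0.eventually)).exists
  have hmem : ∀ o, fam x o ∈ (L x).range := by
    rintro (_ | i)
    · exact hx
    · exact ⟨u i, rfl⟩
  have hli' : LinearIndependent ℝ fun o ↦ (⟨fam x o, hmem o⟩ : (L x).range) :=
    LinearIndependent.of_comp (L x).range.subtype hli
  have := hli'.fintype_card_le_finrank
  simp only [Fintype.card_option, Fintype.card_fin] at this
  omega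

/-- A choice `h` of points of a second countable space over an uncountable set of times has each of
its values as an accumulation value, except at countably many times. -/
theorem countable_setOf_not_frequently {X : Type*} [TopologicalSpace X]
    [SecondCountableTopology X] (h : ℝ → X) (I : Set ℝ) :
    {r ∈ I | ∃ V ∈ 𝓝 (h r), ¬ ∃ᶠ r' in 𝓝[≠] r, r' ∈ I ∧ h r' ∈ V}.Countable := by
  set S := {r ∈ I | ∃ V ∈ 𝓝 (h r), ¬ ∃ᶠ r' in 𝓝[≠] r, r' ∈ I ∧ h r' ∈ V}
  let 𝓑 := TopologicalSpace.countableBasis (ℝ × X)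
  have hbasis := TopologicalSpace.isBasis_countableBasis (ℝ × X)
  -- At an exceptional time the point `(r, h r)` is isolated in the graph of `h`. A basic open set
  -- isolating it determines `r`, so exceptional times inject into a countable basis.
  have key : ∀ r ∈ S, ∃ U ∈ 𝓑, (r, h r) ∈ U ∧ ∀ r' ∈ I, (r', h r') ∈ U → r' = r := by
    rintro r ⟨-, V, hV, hr⟩
    have h1 := eventually_nhdsWithin_iff.1 (Filter.not_frequently.1 hr)
    have h2 : {p : ℝ × X | (p.1 ∈ ({r}ᶜ : Set ℝ) → ¬ (p.1 ∈ I ∧ h p.1 ∈ V)) ∧ p.2 ∈ V} ∈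
        𝓝 (r, h r) := by
      rw [nhds_prod_eq]
      exact Filter.prod_mem_prod h1 hV
    obtain ⟨U, hU, hrU, hUs⟩ := hbasis.mem_nhds_iff.1 h2
    refine ⟨U, hU, hrU, fun r' hr' hr'U ↦ ?_⟩
    by_contra hne
    exact (hUs hr'U).1 hne ⟨hr', (hUs hr'U).2⟩
  choose! U hU hrU hUI using key
  have hinj : InjOn U S := fun r hr r' hr' hrr' ↦
    hUI r' hr' r hr.1 (hrr' ▸ hrU r hr)
  exact MapsTo.countable_of_injOn (t := 𝓑) hU hinj (TopologicalSpace.countable_countableBasis _)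

end ConstantRank

/-! ### Differentials in charts adapted to a submersion. -/

section SubmersionCharts

variable {E : Type*} [NormedAddCommGroup E] [NormedSpace ℝ E]
  {N : Type*} [TopologicalSpace N] [ChartedSpace E N]
  {E' : Type*} [NormedAddCommGroup E'] [NormedSpace ℝ E']
  {N' : Type*} [TopologicalSpace N'] [ChartedSpace E' N']

theorem mdifferentiable_of_mem_maximalAtlas_infty [IsManifold 𝓘(ℝ, E) ∞ N]
    {φ : OpenPartialHomeomorph N E}
    (hφ : φ ∈ IsManifold.maximalAtlas 𝓘(ℝ, E) ∞ N) : φ.MDifferentiable 𝓘(ℝ, E) 𝓘(ℝ, E) :=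
  ⟨(contMDiffOn_of_mem_maximalAtlas hφ).mdifferentiableOn (by simp),
    (contMDiffOn_symm_of_mem_maximalAtlas hφ).mdifferentiableOn (by simp)⟩

/-- The coordinate expression of a map, with respect to a chart of the source and a chart of the
target, has the expected domain of smoothness. -/
theorem contDiffOn_coordinateExpression [IsManifold 𝓘(ℝ, E) ∞ N] [IsManifold 𝓘(ℝ, E') ∞ N']
    {k : N → N'} (hk : ContMDiff 𝓘(ℝ, E) 𝓘(ℝ, E') ∞ k)
    {φ : OpenPartialHomeomorph N E} (hφ : φ ∈ IsManifold.maximalAtlas 𝓘(ℝ, E) ∞ N)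
    {χ : OpenPartialHomeomorph N' E'} (hχ : χ ∈ IsManifold.maximalAtlas 𝓘(ℝ, E') ∞ N') :
    IsOpen (φ.target ∩ φ.symm ⁻¹' (k ⁻¹' χ.source)) ∧
      ContDiffOn ℝ ∞ (χ ∘ k ∘ φ.symm) (φ.target ∩ φ.symm ⁻¹' (k ⁻¹' χ.source)) := by
  refine ⟨φ.isOpen_inter_preimage_symm (χ.open_source.preimage hk.continuous), ?_⟩
  rw [← contMDiffOn_iff_contDiffOn]
  exact (contMDiffOn_of_mem_maximalAtlas hχ).comp
    (hk.comp_contMDiffOn ((contMDiffOn_symm_of_mem_maximalAtlas hφ).mono inter_subset_left))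
    fun z hz ↦ hz.2

/-- Chain rule for two expressions that agree near `h`. It moves differentials to fixed model
spaces, where the constant rank results apply. -/
theorem fderiv_coordinateExpression [IsManifold 𝓘(ℝ, E) ∞ N] [IsManifold 𝓘(ℝ, E') ∞ N']
    {k : N → N'} (hk : ContMDiff 𝓘(ℝ, E) 𝓘(ℝ, E') ∞ k)
    {φ : OpenPartialHomeomorph N E} (hφ : φ ∈ IsManifold.maximalAtlas 𝓘(ℝ, E) ∞ N)
    {χ : OpenPartialHomeomorph N' E'} (hχ : χ ∈ IsManifold.maximalAtlas 𝓘(ℝ, E') ∞ N')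
    {h : N} (hh : h ∈ φ.source) (hh' : k h ∈ χ.source) (u : TangentSpace 𝓘(ℝ, E) h) :
    fderiv ℝ (χ ∘ k ∘ φ.symm) (φ h) (mfderiv 𝓘(ℝ, E) 𝓘(ℝ, E) φ h u) =
      mfderiv 𝓘(ℝ, E') 𝓘(ℝ, E') χ (k h) (mfderiv 𝓘(ℝ, E) 𝓘(ℝ, E') k h u) := by
  have dφ := ((mdifferentiable_of_mem_maximalAtlas_infty hφ).mdifferentiableAt hh).hasMFDerivAt
  have dχ := ((mdifferentiable_of_mem_maximalAtlas_infty hχ).mdifferentiableAt hh').hasMFDerivAt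
  have dk : HasMFDerivAt 𝓘(ℝ, E) 𝓘(ℝ, E') k h _ :=
    (hk.mdifferentiable (by simp) h).hasMFDerivAt
  obtain ⟨ho, hs⟩ := contDiffOn_coordinateExpression hk hφ hχ
  have hmem : φ h ∈ φ.target ∩ φ.symm ⁻¹' (k ⁻¹' χ.source) :=
    ⟨φ.map_source hh, by simpa [φ.left_inv hh] using hh'⟩
  have dτ := ((hs.contDiffAt (ho.mem_nhds hmem)).differentiableAt
    (by simp)).hasFDerivAt.hasMFDerivAt
  have h1 : HasMFDerivAt 𝓘(ℝ, E) 𝓘(ℝ, E') ((χ ∘ k ∘ φ.symm) ∘ φ) h _ := dτ.comp h dφ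
  have h2 : HasMFDerivAt 𝓘(ℝ, E) 𝓘(ℝ, E') (χ ∘ k) h _ := dχ.comp h dk
  have h3 : χ ∘ k =ᶠ[𝓝 h] (χ ∘ k ∘ φ.symm) ∘ φ := by
    filter_upwards [φ.open_source.mem_nhds hh] with z hz
    simp [φ.left_inv hz]
  exact DFunLike.congr_fun (hasMFDerivAt_unique (h1.congr_of_eventuallyEq h3) h2) u

/-- In charts adapted to a submersion `f`, the kernel of `df` is the kernel of a projection. -/
theorem mfderiv_eq_zero_iff_of_charts [IsManifold 𝓘(ℝ, E) ∞ N] [IsManifold 𝓘(ℝ, E') ∞ N']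
    {f : N → N'} (hf : ContMDiff 𝓘(ℝ, E) 𝓘(ℝ, E') ∞ f)
    {φ : OpenPartialHomeomorph N E} (hφ : φ ∈ IsManifold.maximalAtlas 𝓘(ℝ, E) ∞ N)
    {ψ : OpenPartialHomeomorph N' E'} (hψ : ψ ∈ IsManifold.maximalAtlas 𝓘(ℝ, E') ∞ N')
    (hsub : MapsTo f φ.source ψ.source)
    {F : Type*} [NormedAddCommGroup F] [NormedSpace ℝ F] (e : E ≃L[ℝ] E' × F)
    (he : ∀ z ∈ φ.target, ψ (f (φ.symm z)) = (e z).1)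
    {h : N} (hh : h ∈ φ.source) (u : TangentSpace 𝓘(ℝ, E) h) :
    mfderiv 𝓘(ℝ, E) 𝓘(ℝ, E') f h u = 0 ↔ (e (mfderiv 𝓘(ℝ, E) 𝓘(ℝ, E) φ h u : E)).1 = 0 := by
  have h1 := fderiv_coordinateExpression hf hφ hψ hh (hsub hh) u
  have h2 : HasFDerivAt (ψ ∘ f ∘ φ.symm)
      ((ContinuousLinearMap.fst ℝ E' F).comp (e : E →L[ℝ] E' × F)) (φ h) := by
    refine ((ContinuousLinearMap.fst ℝ E' F).comp
      (e : E →L[ℝ] E' × F)).hasFDerivAt.congr_of_eventuallyEq ?_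
    filter_upwards [φ.open_target.mem_nhds (φ.map_source hh)] with z hz
    exact he z hz
  rw [h2.fderiv] at h1
  have h3 : (e (mfderiv 𝓘(ℝ, E) 𝓘(ℝ, E) φ h u : E)).1 =
    mfderiv 𝓘(ℝ, E') 𝓘(ℝ, E') ψ (f h) (mfderiv 𝓘(ℝ, E) 𝓘(ℝ, E') f h u) := h1
  rw [h3]
  constructor
  · intro h4
    rw [h4]
    exact map_zero _
  · intro h4
    exact (mdifferentiable_of_mem_maximalAtlas_infty hψ).mfderiv_injective (hsub hh)
      (h4.trans (map_zero _).symm)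

/-- The differential of a chart, as an endomorphism of the model space. -/
noncomputable def chartDifferential (χ : OpenPartialHomeomorph N E) (z : N) : E →L[ℝ] E :=
  mfderiv 𝓘(ℝ, E) 𝓘(ℝ, E) χ z

theorem chartDifferential_injective [IsManifold 𝓘(ℝ, E) ∞ N] {χ : OpenPartialHomeomorph N E}
    (hχ : χ ∈ IsManifold.maximalAtlas 𝓘(ℝ, E) ∞ N) {z : N} (hz : z ∈ χ.source) :
    Function.Injective (chartDifferential χ z) :=
  (mdifferentiable_of_mem_maximalAtlas_infty hχ).mfderiv_injective hz

/-- Ensures that a rank computed in a chart is the dimension of the intrinsic `orbitDirection`. -/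
theorem finrank_map_chartDifferential [IsManifold 𝓘(ℝ, E) ∞ N] {χ : OpenPartialHomeomorph N E}
    (hχ : χ ∈ IsManifold.maximalAtlas 𝓘(ℝ, E) ∞ N) {z : N} (hz : z ∈ χ.source)
    (D : Submodule ℝ E) :
    Module.finrank ℝ (D.map (chartDifferential χ z).toLinearMap) = Module.finrank ℝ D :=
  (D.equivMapOfInjective _ (chartDifferential_injective hχ hz)).finrank_eq.symm

/-- In charts adapted to a submersion `f`, the image under `dk` of the kernel of `df` is the range
of a partial differential of the coordinate expression of `k`. -/
theorem range_partial_fderiv_eq [IsManifold 𝓘(ℝ, E) ∞ N] [IsManifold 𝓘(ℝ, E') ∞ N']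
    {f k : N → N'} (hf : ContMDiff 𝓘(ℝ, E) 𝓘(ℝ, E') ∞ f) (hk : ContMDiff 𝓘(ℝ, E) 𝓘(ℝ, E') ∞ k)
    {φ : OpenPartialHomeomorph N E} (hφ : φ ∈ IsManifold.maximalAtlas 𝓘(ℝ, E) ∞ N)
    {ψ : OpenPartialHomeomorph N' E'} (hψ : ψ ∈ IsManifold.maximalAtlas 𝓘(ℝ, E') ∞ N')
    (hsub : MapsTo f φ.source ψ.source)
    {F : Type*} [NormedAddCommGroup F] [NormedSpace ℝ F] (e : E ≃L[ℝ] E' × F)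
    (he : ∀ z ∈ φ.target, ψ (f (φ.symm z)) = (e z).1)
    {χ : OpenPartialHomeomorph N' E'} (hχ : χ ∈ IsManifold.maximalAtlas 𝓘(ℝ, E') ∞ N')
    {h : N} (hh : h ∈ φ.source) (hh' : k h ∈ χ.source) :
    ((fderiv ℝ (χ ∘ k ∘ φ.symm) (φ h)).comp
      ((e.symm : E' × F →L[ℝ] E).comp (ContinuousLinearMap.inr ℝ E' F))).range =
    (((mfderiv 𝓘(ℝ, E) 𝓘(ℝ, E') f h : E →L[ℝ] E').ker).map
      (mfderiv 𝓘(ℝ, E) 𝓘(ℝ, E') k h : E →L[ℝ] E').toLinearMap).map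
        (chartDifferential χ (k h)).toLinearMap := by
  have hker := fun u ↦ mfderiv_eq_zero_iff_of_charts hf hφ hψ hsub e he hh u
  have hco := fun u ↦ fderiv_coordinateExpression hk hφ hχ hh hh' u
  apply le_antisymm
  · rintro _ ⟨β, rfl⟩
    obtain ⟨u, hu⟩ := (mdifferentiable_of_mem_maximalAtlas_infty hφ).mfderiv_surjective hh
      (e.symm (0, β) : E)
    have hu' : (mfderiv 𝓘(ℝ, E) 𝓘(ℝ, E) φ h u : E) = e.symm (0, β) := hu
    refine ⟨_, ⟨u, (hker u).2 ?_, rfl⟩, ?_⟩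
    · rw [hu']; simp
    · exact (hco u).symm.trans (congrArg (fderiv ℝ (χ ∘ k ∘ φ.symm) (φ h)) hu')
  · rintro _ ⟨_, ⟨u, hu, rfl⟩, rfl⟩
    have h1 := (hker u).1 hu
    refine ⟨(e (mfderiv 𝓘(ℝ, E) 𝓘(ℝ, E) φ h u : E)).2,
      (congrArg (fderiv ℝ (χ ∘ k ∘ φ.symm) (φ h)) ?_).trans (hco u)⟩
    change e.symm (0, _) = _
    rw [← h1]
    exact e.symm_apply_apply _

end SubmersionCharts

/-! ### Orbit directions and the constancy of their dimension. -/

/-- For surjective `S` and `T` between the same spaces, `T (ker S)` and `S (ker T)` have the same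
dimension. -/
theorem finrank_map_ker_comm {V W : Type*} [AddCommGroup V] [Module ℝ V] [FiniteDimensional ℝ V]
    [AddCommGroup W] [Module ℝ W] {S T : V →ₗ[ℝ] W} (hS : Function.Surjective S)
    (hT : Function.Surjective T) :
    Module.finrank ℝ (S.ker.map T) = Module.finrank ℝ (T.ker.map S) := by
  -- Rank-nullity for `T` restricted to `ker S`. The intersection of the kernels is symmetric in `S`
  -- and `T`, and the two kernels have equal dimension by surjectivity.
  have key : ∀ S T : V →ₗ[ℝ] W, Module.finrank ℝ (S.ker.map T) +
      Module.finrank ℝ (S.ker ⊓ T.ker : Submodule ℝ V) = Module.finrank ℝ S.ker := by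
    intro S T
    have h1 := (T.domRestrict S.ker).finrank_range_add_finrank_ker
    have h2 : (T.domRestrict S.ker).ker.map S.ker.subtype = S.ker ⊓ T.ker := by
      ext u; simp [and_comm]
    rw [LinearMap.range_domRestrict, ← Submodule.finrank_map_subtype_eq, h2] at h1
    exact h1
  have h1 := key S T
  have h2 := key T S
  have h3 := S.finrank_range_add_finrank_ker
  have h4 := T.finrank_range_add_finrank_ker
  rw [LinearMap.range_eq_top.2 hS] at h3
  rw [LinearMap.range_eq_top.2 hT] at h4
  rw [inf_comm] at h2
  omega

namespace LieGroupoid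

variable {EM : Type*} [NormedAddCommGroup EM] [NormedSpace ℝ EM]
  {M : Type*} [TopologicalSpace M] [ChartedSpace EM M]
  {EG : Type*} [NormedAddCommGroup EG] [NormedSpace ℝ EG]
  {G : Type*} [TopologicalSpace G] [ChartedSpace EG G]

/-- The image under `d_g t` of the tangent space `ker d_g s` of the source fibre. -/
noncomputable def orbitDirection (𝒢 : LieGroupoid EM M EG G) (g : G) : Submodule ℝ EM :=
  ((mfderiv 𝓘(ℝ, EG) 𝓘(ℝ, EM) 𝒢.s g : EG →L[ℝ] EM).ker).map
    (mfderiv 𝓘(ℝ, EG) 𝓘(ℝ, EM) 𝒢.t g : EG →L[ℝ] EM).toLinearMap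

theorem mfderiv_anchor (𝒢 : LieGroupoid EM M EG G) (g : G) (u : TangentSpace 𝓘(ℝ, EG) g) :
    mfderiv 𝓘(ℝ, EG) (𝓘(ℝ, EM).prod 𝓘(ℝ, EM)) 𝒢.anchor g u =
      (mfderiv 𝓘(ℝ, EG) 𝓘(ℝ, EM) 𝒢.t g u, mfderiv 𝓘(ℝ, EG) 𝓘(ℝ, EM) 𝒢.s g u) := by
  have dt := (𝒢.isSubmersion_t.contMDiff.mdifferentiable (by simp) g).hasMFDerivAt
  have ds := (𝒢.isSubmersion_s.contMDiff.mdifferentiable (by simp) g).hasMFDerivAt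
  have h : HasMFDerivAt 𝓘(ℝ, EG) (𝓘(ℝ, EM).prod 𝓘(ℝ, EM)) 𝒢.anchor g _ := dt.prodMk ds
  rw [h.mfderiv]
  rfl

variable [IsManifold 𝓘(ℝ, EM) ∞ M] [IsManifold 𝓘(ℝ, EG) ∞ G]

/-- Right multiplication by `k` carries the source fibre of `h` to that of `mul h k` and preserves
targets. The argument differentiates curves in the source fibre, since `mul` is smooth only on
composable pairs. -/
theorem orbitDirection_le_mul (𝒢 : LieGroupoid EM M EG G) {h k : G} (hk : 𝒢.s h = 𝒢.t k) :
    𝒢.orbitDirection h ≤ 𝒢.orbitDirection (𝒢.mul h k) := by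
  have key : submanifoldTangentSpace (E := EG) (𝒢.s ⁻¹' {𝒢.s h}) h ≤
      (𝒢.orbitDirection (𝒢.mul h k)).comap
        (mfderiv 𝓘(ℝ, EG) 𝓘(ℝ, EM) 𝒢.t h : EG →L[ℝ] EM).toLinearMap := by
    refine Submodule.span_le.2 ?_
    rintro v ⟨γ, ε, hε, hγ, hγS, hv⟩
    have hγ0 : γ 0 = h := congrArg Bundle.TotalSpace.proj hv
    subst hγ0
    obtain rfl := tangentVector_ext (N := G) hv
    have h0 : Ioo (-ε) ε ∈ 𝓝 (0 : ℝ) := Ioo_mem_nhds (by linarith) hε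
    have hcomp : ∀ r ∈ Ioo (-ε) ε, 𝒢.s (γ r) = 𝒢.t k := fun r hr ↦ (hγS r hr).trans hk
    have hc : ContMDiffOn 𝓘(ℝ, ℝ) 𝓘(ℝ, EG) ∞ (fun r ↦ 𝒢.mul (γ r) k) (Ioo (-ε) ε) :=
      𝒢.contMDiffOn_mul.comp (hγ.prodMk contMDiffOn_const) hcomp
    have dc := ((hc.contMDiffAt h0).mdifferentiableAt (by simp)).hasMFDerivAt
    have dγ := ((hγ.contMDiffAt h0).mdifferentiableAt (by simp)).hasMFDerivAt
    have ds := (𝒢.isSubmersion_s.contMDiff.mdifferentiable (by simp)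
      (𝒢.mul (γ 0) k)).hasMFDerivAt
    have dt := (𝒢.isSubmersion_t.contMDiff.mdifferentiable (by simp)
      (𝒢.mul (γ 0) k)).hasMFDerivAt
    have dt' := (𝒢.isSubmersion_t.contMDiff.mdifferentiable (by simp) (γ 0)).hasMFDerivAt
    have hs : HasMFDerivAt 𝓘(ℝ, ℝ) 𝓘(ℝ, EM) (𝒢.s ∘ fun r ↦ 𝒢.mul (γ r) k) 0 0 :=
      (hasMFDerivAt_const (𝒢.s k) (0 : ℝ)).congr_of_eventuallyEq
        (Filter.eventually_of_mem h0 fun r hr ↦ 𝒢.s_mul _ _ (hcomp r hr))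
    have ht : HasMFDerivAt 𝓘(ℝ, ℝ) 𝓘(ℝ, EM) (𝒢.t ∘ fun r ↦ 𝒢.mul (γ r) k) 0 _ :=
      (dt'.comp (0 : ℝ) dγ).congr_of_eventuallyEq
        (Filter.eventually_of_mem h0 fun r hr ↦ 𝒢.t_mul _ _ (hcomp r hr))
    refine ⟨mfderiv 𝓘(ℝ, ℝ) 𝓘(ℝ, EG) (fun r ↦ 𝒢.mul (γ r) k) 0 (1 : ℝ), ?_, ?_⟩
    · exact DFunLike.congr_fun (hasMFDerivAt_unique (ds.comp (0 : ℝ) dc) hs) (1 : ℝ)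
    · exact DFunLike.congr_fun (hasMFDerivAt_unique (dt.comp (0 : ℝ) dc) ht) (1 : ℝ)
  rintro _ ⟨u, hu, rfl⟩
  exact key (ker_le_submanifoldTangentSpace_preimage 𝒢.isSubmersion_s
    (mem_singleton (𝒢.s h)) hu)

/-- The direction of the orbits depends only on the target of the arrow. -/
theorem orbitDirection_eq_one (𝒢 : LieGroupoid EM M EG G) (g : G) :
    𝒢.orbitDirection g = 𝒢.orbitDirection (𝒢.one (𝒢.t g)) := by
  apply le_antisymm
  · have := 𝒢.orbitDirection_le_mul (𝒢.t_inv g).symm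
    rwa [𝒢.mul_inv] at this
  · have := 𝒢.orbitDirection_le_mul (h := 𝒢.one (𝒢.t g)) (k := g) (𝒢.s_one _)
    rwa [𝒢.one_mul] at this

variable [FiniteDimensional ℝ EM] [FiniteDimensional ℝ EG]

/-- By `finrank_map_ker_comm` the left side is the dimension of `ds (ker dt)` at `g`; since `inv`
exchanges `s` and `t`, its differential shows that this space lies in the direction at `inv g`. -/
theorem finrank_orbitDirection_le_inv (𝒢 : LieGroupoid EM M EG G) (g : G) :
    Module.finrank ℝ (𝒢.orbitDirection g) ≤ Module.finrank ℝ (𝒢.orbitDirection (𝒢.inv g)) := by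
  let K : Submodule ℝ EM := ((mfderiv 𝓘(ℝ, EG) 𝓘(ℝ, EM) 𝒢.t g : EG →L[ℝ] EM).ker).map
    (mfderiv 𝓘(ℝ, EG) 𝓘(ℝ, EM) 𝒢.s g : EG →L[ℝ] EM).toLinearMap
  have h1 : Module.finrank ℝ (𝒢.orbitDirection g) = Module.finrank ℝ K :=
    finrank_map_ker_comm (V := EG) (W := EM)
      (mfderiv_surjective_of_isSubmersion 𝒢.isSubmersion_s g)
      (mfderiv_surjective_of_isSubmersion 𝒢.isSubmersion_t g)
  suffices h2 : K ≤ 𝒢.orbitDirection (𝒢.inv g) from h1.trans_le (Submodule.finrank_mono h2)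
  have di := (𝒢.contMDiff_inv.mdifferentiable (by simp) g).hasMFDerivAt
  have ds := (𝒢.isSubmersion_s.contMDiff.mdifferentiable (by simp) (𝒢.inv g)).hasMFDerivAt
  have dt := (𝒢.isSubmersion_t.contMDiff.mdifferentiable (by simp) (𝒢.inv g)).hasMFDerivAt
  have ds' : HasMFDerivAt 𝓘(ℝ, EG) 𝓘(ℝ, EM) (𝒢.t ∘ 𝒢.inv) g _ :=
    (𝒢.isSubmersion_s.contMDiff.mdifferentiable (by simp) g).hasMFDerivAt.congr_of_eventuallyEq
      (.of_forall 𝒢.t_inv)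
  have dt' : HasMFDerivAt 𝓘(ℝ, EG) 𝓘(ℝ, EM) (𝒢.s ∘ 𝒢.inv) g _ :=
    (𝒢.isSubmersion_t.contMDiff.mdifferentiable (by simp) g).hasMFDerivAt.congr_of_eventuallyEq
      (.of_forall 𝒢.s_inv)
  rintro _ ⟨u, hu, rfl⟩
  refine ⟨mfderiv 𝓘(ℝ, EG) 𝓘(ℝ, EG) 𝒢.inv g u, ?_, ?_⟩
  · exact (DFunLike.congr_fun (hasMFDerivAt_unique (ds.comp g di) dt') u).trans hu
  · exact DFunLike.congr_fun (hasMFDerivAt_unique (dt.comp g di) ds') u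

/-- The dimension of the direction of the orbits is the same at both ends of an arrow. -/
theorem finrank_orbitDirection_one (𝒢 : LieGroupoid EM M EG G) (g : G) :
    Module.finrank ℝ (𝒢.orbitDirection g) =
      Module.finrank ℝ (𝒢.orbitDirection (𝒢.one (𝒢.s g))) := by
  rw [← 𝒢.t_inv g, ← 𝒢.orbitDirection_eq_one]
  refine le_antisymm (𝒢.finrank_orbitDirection_le_inv g) ?_
  -- The arrows `inv (inv g)` and `g` have the same target, hence the same direction; their equality
  -- is not needed.
  have h1 := 𝒢.finrank_orbitDirection_le_inv (𝒢.inv g)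
  rwa [𝒢.orbitDirection_eq_one (𝒢.inv (𝒢.inv g)), 𝒢.t_inv, 𝒢.s_inv,
    ← 𝒢.orbitDirection_eq_one] at h1

end LieGroupoid

/-! ### Local parametrization of source fibres. -/

namespace LieGroupoid

universe u

variable {EM : Type*} [NormedAddCommGroup EM] [NormedSpace ℝ EM]
  {M : Type*} [TopologicalSpace M] [ChartedSpace EM M] [IsManifold 𝓘(ℝ, EM) ∞ M]
  {EG : Type u} [NormedAddCommGroup EG] [NormedSpace ℝ EG]
  {G : Type*} [TopologicalSpace G] [ChartedSpace EG G] [IsManifold 𝓘(ℝ, EG) ∞ G]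

/-- A smooth parametrization `κ` of the source fibre near an arrow, with an inverse `q` on the
fibre, in which the differential of the target map is described by `orbitDirection`. -/
theorem exists_sourceFibre_parametrization [FiniteDimensional ℝ EG] (𝒢 : LieGroupoid EM M EG G)
    (g : G) :
    ∃ (F : Type u) (_ : NormedAddCommGroup F) (_ : NormedSpace ℝ F) (_ : FiniteDimensional ℝ F)
      (κ : F → G) (q : G → F) (B : Set F),
      IsOpen B ∧ q g ∈ B ∧ κ (q g) = g ∧ ContMDiffOn 𝓘(ℝ, F) 𝓘(ℝ, EG) ∞ κ B ∧
      (∀ b ∈ B, 𝒢.s (κ b) = 𝒢.s g ∧ 𝒢.t (κ b) ∈ (chartAt EM (𝒢.t g)).source) ∧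
      ContDiffOn ℝ ∞ (chartAt EM (𝒢.t g) ∘ 𝒢.t ∘ κ) B ∧
      ContinuousAt q g ∧ (∀ᶠ h in 𝓝 g, 𝒢.s h = 𝒢.s g → κ (q h) = h) ∧
      (∀ u : EG, (mfderiv 𝓘(ℝ, EG) 𝓘(ℝ, EM) 𝒢.s g u : EM) = 0 →
        ∃ β : F, (mfderiv 𝓘(ℝ, F) 𝓘(ℝ, EG) κ (q g) β : EG) = u) ∧
      ∀ b ∈ B, (fderiv ℝ (chartAt EM (𝒢.t g) ∘ 𝒢.t ∘ κ) b).range =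
        (𝒢.orbitDirection (κ b)).map (chartDifferential (chartAt EM (𝒢.t g))
          (𝒢.t (κ b))).toLinearMap := by
  obtain ⟨F, _, _, hF⟩ := 𝒢.isSubmersion_s
  have hs := 𝒢.isSubmersion_s.contMDiff
  have ht := 𝒢.isSubmersion_t.contMDiff
  obtain ⟨φ, ψ, hgφ, hgψ, hφ, hψ, hsub, e, he⟩ := hF g
  have he' : ∀ z ∈ φ.target, ψ (𝒢.s (φ.symm z)) = (e z).1 := by
    intro z hz
    have := he (x := z) (by simpa using hz)
    simpa using this
  have he'' : ∀ h ∈ φ.source, (e (φ h)).1 = ψ (𝒢.s h) := by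
    intro h hh
    rw [← he' _ (φ.map_source hh), φ.left_inv hh]
  have hfin : FiniteDimensional ℝ F := FiniteDimensional.of_surjective
    ((ContinuousLinearMap.snd ℝ EM F).comp (e : EG →L[ℝ] EM × F)).toLinearMap
    (Prod.snd_surjective.comp e.surjective)
  have hχ : chartAt EM (𝒢.t g) ∈ IsManifold.maximalAtlas 𝓘(ℝ, EM) ∞ M :=
    IsManifold.chart_mem_maximalAtlas _
  obtain ⟨hΩ, hτ⟩ := contDiffOn_coordinateExpression ht hφ hχ
  set Ω := φ.target ∩ φ.symm ⁻¹' (𝒢.t ⁻¹' (chartAt EM (𝒢.t g)).source)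
  -- In adapted coordinates the source is the first component of `e`; freezing it at its value for
  -- `g` leaves `F` as coordinates on the source fibre. The preimage of `Ω` also keeps targets
  -- inside the chart at `t g`.
  let j : F → EG := fun b ↦ e.symm ((e (φ g)).1, b)
  have hj : ContDiff ℝ ∞ j := by fun_prop
  have hjd : ∀ b, HasFDerivAt j ((e.symm : EM × F →L[ℝ] EG).comp
      (ContinuousLinearMap.inr ℝ EM F)) b := fun b ↦
    (e.symm : EM × F →L[ℝ] EG).hasFDerivAt.comp b (hasFDerivAt_prodMk_right _ b)
  have hjg : j (e (φ g)).2 = φ g := e.symm_apply_apply _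
  have hκj : ∀ b ∈ j ⁻¹' Ω, φ (φ.symm (j b)) = j b := fun b hb ↦ φ.right_inv hb.1
  refine ⟨F, _, _, hfin, φ.symm ∘ j, fun h ↦ (e (φ h)).2, j ⁻¹' Ω, hΩ.preimage hj.continuous,
    ?_, ?_, ?_, ?_, ?_, ?_, ?_, ?_, ?_⟩
  · change j (e (φ g)).2 ∈ Ω
    rw [hjg]
    exact ⟨φ.map_source hgφ, by
      change 𝒢.t (φ.symm (φ g)) ∈ (chartAt EM (𝒢.t g)).source
      rw [φ.left_inv hgφ]; exact mem_chart_source _ _⟩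
  · change φ.symm (j (e (φ g)).2) = g
    rw [hjg, φ.left_inv hgφ]
  · exact (contMDiffOn_symm_of_mem_maximalAtlas hφ).comp hj.contMDiff.contMDiffOn fun b hb ↦ hb.1
  · intro b hb
    refine ⟨ψ.injOn (hsub (φ.map_target hb.1)) hgψ ?_, hb.2⟩
    rw [← he'' g hgφ]
    exact (he' _ hb.1).trans (by simp [j])
  · exact hτ.comp hj.contDiffOn fun b hb ↦ hb
  · exact continuous_snd.continuousAt.comp (e.continuous.continuousAt.comp (φ.continuousAt hgφ))
  · filter_upwards [φ.open_source.mem_nhds hgφ] with h hh hsh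
    have h1 : j (e (φ h)).2 = φ h := by
      have : ((e (φ g)).1, (e (φ h)).2) = e (φ h) := by
        rw [he'' g hgφ, ← hsh, ← he'' h hh]
      change e.symm ((e (φ g)).1, (e (φ h)).2) = φ h
      rw [this, e.symm_apply_apply]
    change φ.symm (j (e (φ h)).2) = h
    rw [h1, φ.left_inv hh]
  · intro u hu
    have h1 := (mfderiv_eq_zero_iff_of_charts hs hφ hψ hsub e he' hgφ u).1 hu
    have dφ := mdifferentiable_of_mem_maximalAtlas_infty hφ
    have hjt : j (e (φ g)).2 ∈ φ.target := by
      rw [hjg]; exact φ.map_source hgφ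
    have d1 := (dφ.mdifferentiableAt_symm hjt).hasMFDerivAt
    have d2 := d1.comp (e (φ g)).2 (hjd _).hasMFDerivAt
    let a : EG := mfderiv 𝓘(ℝ, EG) 𝓘(ℝ, EG) φ g u
    have h2 : e.symm (0, (e a).2) = a := by
      have : ((0 : EM), (e a).2) = e a := Prod.ext h1.symm rfl
      rw [this, e.symm_apply_apply]
    refine ⟨(e a).2, ?_⟩
    rw [d2.mfderiv]
    have h3 := DFunLike.congr_fun (dφ.symm_comp_deriv hgφ) u
    change (mfderiv 𝓘(ℝ, EG) 𝓘(ℝ, EG) φ.symm (j (e (φ g)).2) (e.symm (0, (e a).2) : EG) : EG) = u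
    rw [h2, hjg]
    exact h3
  · intro b hb
    have d1 : HasFDerivAt ((chartAt EM (𝒢.t g) ∘ 𝒢.t ∘ φ.symm) ∘ j) _ b :=
      ((hτ.contDiffAt (hΩ.mem_nhds hb)).differentiableAt (by simp)).hasFDerivAt.comp b (hjd b)
    have h1 := range_partial_fderiv_eq hs ht hφ hψ hsub e he' hχ (φ.map_target hb.1) hb.2
    rw [hκj b hb] at h1
    rw [show chartAt EM (𝒢.t g) ∘ 𝒢.t ∘ φ.symm ∘ j =
      (chartAt EM (𝒢.t g) ∘ 𝒢.t ∘ φ.symm) ∘ j from rfl, d1.fderiv]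
    exact h1

end LieGroupoid

/-! ### Tangent vectors to `G(y, x)` and to orbits. -/

namespace LieGroupoid

variable {EM : Type*} [NormedAddCommGroup EM] [NormedSpace ℝ EM]
  {M : Type*} [TopologicalSpace M] [ChartedSpace EM M] [IsManifold 𝓘(ℝ, EM) ∞ M]
  {EG : Type*} [NormedAddCommGroup EG] [NormedSpace ℝ EG]
  {G : Type*} [TopologicalSpace G] [ChartedSpace EG G] [IsManifold 𝓘(ℝ, EG) ∞ G]

variable [FiniteDimensional ℝ EM] [FiniteDimensional ℝ EG]

/-- A vector killed by `d_g s` and by `d_g t` is tangent to `G(t g, s g)`. -/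
theorem mem_submanifoldTangentSpace_arrows (𝒢 : LieGroupoid EM M EG G) (g : G) (u : EG)
    (hs : (mfderiv 𝓘(ℝ, EG) 𝓘(ℝ, EM) 𝒢.s g u : EM) = 0)
    (ht : (mfderiv 𝓘(ℝ, EG) 𝓘(ℝ, EM) 𝒢.t g u : EM) = 0) :
    (u : TangentSpace 𝓘(ℝ, EG) g) ∈ submanifoldTangentSpace (𝒢.arrows (𝒢.t g) (𝒢.s g)) g := by
  obtain ⟨F, _, _, _, κ, q, B, hB, hqB, hκq, hκ, hBst, hf, -, -, hker, hrange⟩ :=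
    𝒢.exists_sourceFibre_parametrization g
  have hχ : chartAt EM (𝒢.t g) ∈ IsManifold.maximalAtlas 𝓘(ℝ, EM) ∞ M :=
    IsManifold.chart_mem_maximalAtlas _
  -- All arrows `κ b` have source `s g`, so their directions have the same dimension.
  have hrank : ∀ b ∈ B, Module.finrank ℝ (fderiv ℝ (chartAt EM (𝒢.t g) ∘ 𝒢.t ∘ κ) b).range =
      Module.finrank ℝ (𝒢.orbitDirection (𝒢.one (𝒢.s g))) := by
    intro b hb
    rw [hrange b hb, finrank_map_chartDifferential hχ (hBst b hb).2, 𝒢.finrank_orbitDirection_one,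
      (hBst b hb).1]
  obtain ⟨β, hβ⟩ := hker u hs
  have dκ := ((hκ.contMDiffAt (hB.mem_nhds hqB)).mdifferentiableAt (by simp)).hasMFDerivAt
  have dt : HasMFDerivAt 𝓘(ℝ, EG) 𝓘(ℝ, EM) 𝒢.t (κ (q g)) _ :=
    (𝒢.isSubmersion_t.contMDiff.mdifferentiable (by simp) (κ (q g))).hasMFDerivAt
  have dχ : HasMFDerivAt 𝓘(ℝ, EM) 𝓘(ℝ, EM) (chartAt EM (𝒢.t g)) (𝒢.t (κ (q g))) _ :=
    ((mdifferentiable_of_mem_maximalAtlas_infty hχ).mdifferentiableAt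
      (hBst _ hqB).2).hasMFDerivAt
  have hβ0 : fderiv ℝ (chartAt EM (𝒢.t g) ∘ 𝒢.t ∘ κ) (q g) β = 0 := by
    have d1 := ((hf.contDiffAt (hB.mem_nhds hqB)).differentiableAt
      (by simp)).hasFDerivAt.hasMFDerivAt
    have h1 := DFunLike.congr_fun
      (hasMFDerivAt_unique d1 (dχ.comp (q g) (dt.comp (q g) dκ))) β
    refine h1.trans ?_
    have h2 : (mfderiv 𝓘(ℝ, EG) 𝓘(ℝ, EM) 𝒢.t (κ (q g))
        (mfderiv 𝓘(ℝ, F) 𝓘(ℝ, EG) κ (q g) β : EG) : EM) = 0 := by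
      rw [hβ, hκq]; exact ht
    exact (congrArg (mfderiv 𝓘(ℝ, EM) 𝓘(ℝ, EM) (chartAt EM (𝒢.t g)) (𝒢.t (κ (q g))) :
      EM → EM) h2).trans (map_zero _)
  obtain ⟨c, ε, hε, hc, hcB, hc0, hcd, hconst⟩ := exists_curve_of_constantRank hB hqB hf
    (fun b hb ↦ (hrank b hb).trans (hrank _ hqB).symm) hβ0
  refine Submodule.subset_span ⟨κ ∘ c, ε, hε, hκ.comp hc.contMDiffOn hcB, ?_, ?_⟩
  · intro r hr
    have hb := hcB hr
    refine ⟨(chartAt EM (𝒢.t g)).injOn (hBst _ hb).2 (mem_chart_source _ _) ?_, (hBst _ hb).1⟩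
    refine (hconst r hr).trans ?_
    simp [hκq]
  · rw [← hc0] at dκ
    have d1 := dκ.comp (0 : ℝ) hcd.hasFDerivAt.hasMFDerivAt
    have h0 : (κ ∘ c) 0 = g := by rw [Function.comp_apply, hc0, hκq]
    unfold tangentMap
    dsimp only
    rw [d1.mfderiv, h0]
    refine congrArg (Bundle.TotalSpace.mk g) ?_
    refine Eq.trans ?_ hβ
    rw [← hc0]
    exact congrArg (mfderiv 𝓘(ℝ, F) 𝓘(ℝ, EG) κ (c 0) : F → EG) (one_smul ℝ β)

/-- The velocity of a curve in an orbit is in the direction of the orbit, at every time at which a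
choice of arrows over the curve accumulates. -/
theorem mfderiv_mem_orbitDirection_of_frequently (𝒢 : LieGroupoid EM M EG G) {x : M} {γ : ℝ → M}
    {h : ℝ → G} {I : Set ℝ} {r : ℝ} (hr : r ∈ I) (hs : ∀ r ∈ I, 𝒢.s (h r) = x)
    (ht : ∀ r ∈ I, 𝒢.t (h r) = γ r) (hγ : MDifferentiableAt 𝓘(ℝ, ℝ) 𝓘(ℝ, EM) γ r)
    (hfreq : ∀ V ∈ 𝓝 (h r), ∃ᶠ r' in 𝓝[≠] r, r' ∈ I ∧ h r' ∈ V) :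
    (mfderiv 𝓘(ℝ, ℝ) 𝓘(ℝ, EM) γ r (1 : ℝ) : EM) ∈ 𝒢.orbitDirection (h r) := by
  obtain ⟨F, _, _, _, κ, q, B, hB, hqB, hκq, hκ, hBst, hf, hq, hqκ, hker, hrange⟩ :=
    𝒢.exists_sourceFibre_parametrization (h r)
  have hχ : chartAt EM (𝒢.t (h r)) ∈ IsManifold.maximalAtlas 𝓘(ℝ, EM) ∞ M :=
    IsManifold.chart_mem_maximalAtlas _
  have hrank : ∀ b ∈ B, Module.finrank ℝ
      (fderiv ℝ (chartAt EM (𝒢.t (h r)) ∘ 𝒢.t ∘ κ) b).range =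
      Module.finrank ℝ (𝒢.orbitDirection (𝒢.one (𝒢.s (h r)))) := by
    intro b hb
    rw [hrange b hb, finrank_map_chartDifferential hχ (hBst b hb).2, 𝒢.finrank_orbitDirection_one,
      (hBst b hb).1]
  have hγr : γ r ∈ (chartAt EM (𝒢.t (h r))).source := by
    rw [← ht r hr]; exact mem_chart_source _ _
  have dχ := mdifferentiable_of_mem_maximalAtlas_infty hχ
  have dy : HasFDerivAt (chartAt EM (𝒢.t (h r)) ∘ γ)
      ((chartDifferential (chartAt EM (𝒢.t (h r))) (γ r)).comp
        (mfderiv 𝓘(ℝ, ℝ) 𝓘(ℝ, EM) γ r : ℝ →L[ℝ] EM)) r :=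
    hasMFDerivAt_iff_hasFDerivAt.1
      ((dχ.mdifferentiableAt hγr).hasMFDerivAt.comp r hγ.hasMFDerivAt)
  have hy : HasDerivAt (chartAt EM (𝒢.t (h r)) ∘ γ)
      (chartDifferential (chartAt EM (𝒢.t (h r))) (γ r)
        (mfderiv 𝓘(ℝ, ℝ) 𝓘(ℝ, EM) γ r (1 : ℝ))) r := dy.hasDerivAt
  have hmem := mem_range_fderiv_of_frequently hB hqB hf
    (fun b hb ↦ (hrank b hb).trans (hrank _ hqB).symm) hy (by simp [hκq, ht r hr]) (by
      intro V hV
      -- Arrows `h r'` near `h r` lie in the same source fibre, so `κ (q (h r')) = h r'`: the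
      -- parameter `q (h r')` in `V` witnesses that the curve meets the local image.
      refine (hfreq _ (Filter.inter_mem (hq hV) hqκ)).mono ?_
      rintro r' ⟨hr', hr'V, hr'κ⟩
      refine ⟨q (h r'), hr'V, ?_⟩
      have := hr'κ ((hs r' hr').trans (hs r hr).symm)
      simp [this, ht r' hr'])
  rw [hrange _ hqB, hκq, ht r hr] at hmem
  obtain ⟨v, hv, hvw⟩ := hmem
  exact chartDifferential_injective (IsManifold.chart_mem_maximalAtlas _) (mem_chart_source _ _)
    hvw ▸ hv

/-- The tangent space of an orbit is contained in the image under `dt` of the tangent space of the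
source fibre. -/
theorem orbitTangentSpace_le (𝒢 : LieGroupoid EM M EG G) [SecondCountableTopology G] (y : M) :
    ∀ v : EM, (v : TangentSpace 𝓘(ℝ, EM) y) ∈ 𝒢.orbitTangentSpace y →
      v ∈ 𝒢.orbitDirection (𝒢.one y) := by
  suffices key : submanifoldTangentSpace (E := EM) (𝒢.orbit y) y ≤ 𝒢.orbitDirection (𝒢.one y) from
    fun v hv ↦ key hv
  refine Submodule.span_le.2 ?_
  rintro v ⟨γ, ε, hε, hγ, hγO, hv⟩
  have hγ0 : γ 0 = y := congrArg Bundle.TotalSpace.proj hv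
  subst hγ0
  obtain rfl := tangentVector_ext (N := M) hv
  have h0 : Ioo (-ε) ε ∈ 𝓝 (0 : ℝ) := Ioo_mem_nhds (by linarith) hε
  have hγd : ∀ r ∈ Ioo (-ε) ε, MDifferentiableAt 𝓘(ℝ, ℝ) 𝓘(ℝ, EM) γ r := fun r hr ↦
    (hγ.contMDiffAt (isOpen_Ioo.mem_nhds hr)).mdifferentiableAt (by simp)
  have : Nonempty G := ⟨𝒢.one (γ 0)⟩
  -- An arbitrary choice of arrows over the curve, with no continuity in the time.
  choose! h hs ht using hγO
  have hdense := (countable_setOf_not_frequently h (Ioo (-ε) ε)).dense_compl ℝ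
  -- charts adapted to the source map near the unit
  have hsm := 𝒢.isSubmersion_s.contMDiff
  have htm := 𝒢.isSubmersion_t.contMDiff
  obtain ⟨F, _, _, hF⟩ := 𝒢.isSubmersion_s
  obtain ⟨φ, ψ, hgφ, hgψ, hφ, hψ, hsub, e, he⟩ := hF (𝒢.one (γ 0))
  have he' : ∀ z ∈ φ.target, ψ (𝒢.s (φ.symm z)) = (e z).1 := by
    intro z hz
    have := he (x := z) (by simpa using hz)
    simpa using this
  have hfin : FiniteDimensional ℝ F := FiniteDimensional.of_surjective
    ((ContinuousLinearMap.snd ℝ EM F).comp (e : EG →L[ℝ] EM × F)).toLinearMap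
    (Prod.snd_surjective.comp e.surjective)
  set χ := chartAt EM (γ 0)
  have hχ : χ ∈ IsManifold.maximalAtlas 𝓘(ℝ, EM) ∞ M := IsManifold.chart_mem_maximalAtlas _
  have hχ0 : γ 0 ∈ χ.source := mem_chart_source _ _
  obtain ⟨hΩ, hτ⟩ := contDiffOn_coordinateExpression htm hφ hχ
  -- The directions are read off at the units over the curve, which vary continuously although `h`
  -- does not. By `orbitDirection_eq_one` these are the same directions as at the arrows `h r`.
  let L : ℝ → F →L[ℝ] EM := fun r ↦ (fderiv ℝ (χ ∘ 𝒢.t ∘ φ.symm) (φ (𝒢.one (γ r)))).comp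
    ((e.symm : EM × F →L[ℝ] EG).comp (ContinuousLinearMap.inr ℝ EM F))
  have hL : ∀ r, 𝒢.one (γ r) ∈ φ.source → γ r ∈ χ.source → (L r).range =
      (𝒢.orbitDirection (𝒢.one (γ r))).map
        (chartDifferential χ (γ r)).toLinearMap := by
    intro r h1 h2
    have h3 := 𝒢.t_one (γ r)
    have h4 := range_partial_fderiv_eq hsm htm hφ hψ hsub e he' hχ h1 (by rwa [h3])
    have h5 : ∀ z, z = γ r → (𝒢.orbitDirection (𝒢.one (γ r))).map
        (chartDifferential χ z).toLinearMap =
        (𝒢.orbitDirection (𝒢.one (γ r))).map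
        (chartDifferential χ (γ r)).toLinearMap := by
      rintro z rfl; rfl
    exact h4.trans (h5 _ h3)
  let w : ℝ → EM := deriv (χ ∘ γ)
  have hw : ∀ r ∈ Ioo (-ε) ε, γ r ∈ χ.source → w r =
      chartDifferential χ (γ r) (mfderiv 𝓘(ℝ, ℝ) 𝓘(ℝ, EM) γ r (1 : ℝ)) := by
    intro r hr h2
    have dy : HasFDerivAt (χ ∘ γ) ((chartDifferential χ (γ r)).comp
        (mfderiv 𝓘(ℝ, ℝ) 𝓘(ℝ, EM) γ r : ℝ →L[ℝ] EM)) r :=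
      hasMFDerivAt_iff_hasFDerivAt.1 (((mdifferentiable_of_mem_maximalAtlas_infty
        hχ).mdifferentiableAt h2).hasMFDerivAt.comp r (hγd r hr).hasMFDerivAt)
    exact dy.hasDerivAt.deriv
  have hγ0 : ContMDiffAt 𝓘(ℝ, ℝ) 𝓘(ℝ, EM) ∞ γ 0 := hγ.contMDiffAt h0
  have h1γ : ContinuousAt (fun r ↦ 𝒢.one (γ r)) 0 :=
    𝒢.contMDiff_one.continuous.continuousAt.comp hγ0.continuousAt
  have hwc : ContinuousAt w 0 := by
    have h1 : ContMDiffAt 𝓘(ℝ, ℝ) 𝓘(ℝ, EM) ∞ (χ ∘ γ) 0 :=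
      (contMDiffAt_of_mem_maximalAtlas hχ hχ0).comp (0 : ℝ) hγ0
    have h2 := (contMDiffAt_iff_contDiffAt.1 h1).continuousAt_fderiv (by simp)
    have h3 := h2.clm_apply (continuousAt_const (y := (1 : ℝ)))
    exact h3
  have hLc : ContinuousAt L 0 := by
    have hmem : φ (𝒢.one (γ 0)) ∈ φ.target ∩ φ.symm ⁻¹' (𝒢.t ⁻¹' χ.source) :=
      ⟨φ.map_source hgφ, by
        change 𝒢.t (φ.symm (φ (𝒢.one (γ 0)))) ∈ χ.source
        rwa [φ.left_inv hgφ, 𝒢.t_one]⟩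
    have h1 := (hτ.contDiffAt (hΩ.mem_nhds hmem)).continuousAt_fderiv (by simp)
    have h2 : ContinuousAt (fun r ↦ φ (𝒢.one (γ r))) 0 :=
      ContinuousAt.comp (f := fun r ↦ 𝒢.one (γ r)) (φ.continuousAt hgφ) h1γ
    exact (ContinuousAt.comp (f := fun r ↦ φ (𝒢.one (γ r))) h1 h2).clm_comp continuousAt_const
  have hev : ∀ᶠ r in 𝓝 (0 : ℝ), r ∈ Ioo (-ε) ε ∧ 𝒢.one (γ r) ∈ φ.source ∧ γ r ∈ χ.source :=
    Filter.Eventually.and h0 (Filter.Eventually.and (h1γ (φ.open_source.mem_nhds hgφ))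
      (hγ0.continuousAt (χ.open_source.mem_nhds hχ0)))
  have hrank : ∀ r ∈ Ioo (-ε) ε, 𝒢.one (γ r) ∈ φ.source → γ r ∈ χ.source →
      Module.finrank ℝ (L r).range = Module.finrank ℝ (𝒢.orbitDirection (𝒢.one (γ 0))) := by
    intro r hr h1 h2
    rw [hL r h1 h2, finrank_map_chartDifferential hχ h2, ← ht r hr, ← 𝒢.orbitDirection_eq_one,
      𝒢.finrank_orbitDirection_one, hs r hr]
  have hmem : w 0 ∈ (L 0).range := by
    refine mem_range_of_frequently hLc hwc ?_
    -- Non-exceptional times are dense, hence occur arbitrarily close to `0`, which may itself be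
    -- exceptional.
    refine ((mem_closure_iff_frequently.1 (hdense 0)).and_eventually hev).mono ?_
    rintro r ⟨hrS, hr, h1, h2⟩
    refine ⟨?_, ((hrank r hr h1 h2).trans
      (hrank 0 (mem_of_mem_nhds h0) hgφ hχ0).symm).le⟩
    rw [hL r h1 h2, hw r hr h2]
    refine ⟨_, ?_, rfl⟩
    rw [← ht r hr, ← 𝒢.orbitDirection_eq_one]
    refine 𝒢.mfderiv_mem_orbitDirection_of_frequently hr hs ht (hγd r hr) fun V hV ↦ ?_
    by_contra hnot
    exact hrS ⟨hr, V, hV, hnot⟩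
  rw [hL 0 hgφ hχ0, hw 0 (mem_of_mem_nhds h0) hχ0] at hmem
  obtain ⟨v, hv, hvw⟩ := hmem
  exact chartDifferential_injective hχ hχ0 hvw ▸ hv

end LieGroupoid

/-! ### Kernel and image of the differential of the anchor. -/

theorem mainTheorem7
    {EM : Type*} [NormedAddCommGroup EM] [NormedSpace ℝ EM] [FiniteDimensional ℝ EM]
    {M : Type*} [TopologicalSpace M] [T2Space M] [SecondCountableTopology M]
    [ChartedSpace EM M] [IsManifold 𝓘(ℝ, EM) ∞ M]
    {EG : Type*} [NormedAddCommGroup EG] [NormedSpace ℝ EG] [FiniteDimensional ℝ EG]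
    {G : Type*} [TopologicalSpace G] [T2Space G] [SecondCountableTopology G]
    [ChartedSpace EG G] [IsManifold 𝓘(ℝ, EG) ∞ G]
    (𝒢 : LieGroupoid EM M EG G) (g : G) :
    (mfderiv 𝓘(ℝ, EG) (𝓘(ℝ, EM).prod 𝓘(ℝ, EM)) 𝒢.anchor g).ker =
        submanifoldTangentSpace (𝒢.arrows (𝒢.t g) (𝒢.s g)) g ∧
      ∀ (v : TangentSpace 𝓘(ℝ, EM) (𝒢.t g)) (w : TangentSpace 𝓘(ℝ, EM) (𝒢.s g)),
        ((v, w) : TangentSpace (𝓘(ℝ, EM).prod 𝓘(ℝ, EM)) (𝒢.anchor g)) ∈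
            (mfderiv 𝓘(ℝ, EG) (𝓘(ℝ, EM).prod 𝓘(ℝ, EM)) 𝒢.anchor g).range ↔
          (Submodule.Quotient.mk v : 𝒢.NormalSpace (𝒢.t g)) =
            𝒢.normalRep g (Submodule.Quotient.mk w) := by
  refine ⟨le_antisymm ?_ ?_, fun v w ↦ ⟨?_, fun hvw ↦ ?_⟩⟩
  · intro u hu
    have h1 := (𝒢.mfderiv_anchor g u).symm.trans hu
    exact 𝒢.mem_submanifoldTangentSpace_arrows g u (congrArg Prod.snd h1) (congrArg Prod.fst h1)
  · refine Submodule.span_le.2 ?_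
    rintro v ⟨γ, ε, hε, hγ, hγS, hv⟩
    have hγ0 : γ 0 = g := congrArg Bundle.TotalSpace.proj hv
    subst hγ0
    obtain rfl := tangentVector_ext (N := G) hv
    have h0 : Ioo (-ε) ε ∈ 𝓝 (0 : ℝ) := Ioo_mem_nhds (by linarith) hε
    have dγ := ((hγ.contMDiffAt h0).mdifferentiableAt (by simp)).hasMFDerivAt
    have ds := (𝒢.isSubmersion_s.contMDiff.mdifferentiable (by simp) (γ 0)).hasMFDerivAt
    have dt := (𝒢.isSubmersion_t.contMDiff.mdifferentiable (by simp) (γ 0)).hasMFDerivAt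
    have hs : HasMFDerivAt 𝓘(ℝ, ℝ) 𝓘(ℝ, EM) (𝒢.s ∘ γ) 0 0 :=
      (hasMFDerivAt_const (𝒢.s (γ 0)) (0 : ℝ)).congr_of_eventuallyEq
        (Filter.eventually_of_mem h0 fun r hr ↦ (hγS r hr).2)
    have ht : HasMFDerivAt 𝓘(ℝ, ℝ) 𝓘(ℝ, EM) (𝒢.t ∘ γ) 0 0 :=
      (hasMFDerivAt_const (𝒢.t (γ 0)) (0 : ℝ)).congr_of_eventuallyEq
        (Filter.eventually_of_mem h0 fun r hr ↦ (hγS r hr).1)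
    exact (𝒢.mfderiv_anchor (γ 0) _).trans (Prod.ext
      (DFunLike.congr_fun (hasMFDerivAt_unique (dt.comp (0 : ℝ) dγ) ht) (1 : ℝ))
      (DFunLike.congr_fun (hasMFDerivAt_unique (ds.comp (0 : ℝ) dγ) hs) (1 : ℝ)))
  · rintro ⟨u, hu⟩
    have h1 := (𝒢.mfderiv_anchor g u).symm.trans hu
    obtain rfl : mfderiv 𝓘(ℝ, EG) 𝓘(ℝ, EM) 𝒢.t g u = v := congrArg Prod.fst h1
    obtain rfl : mfderiv 𝓘(ℝ, EG) 𝓘(ℝ, EM) 𝒢.s g u = w := congrArg Prod.snd h1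
    exact (𝒢.normalRep_mk g u).symm
  · obtain ⟨u, rfl⟩ := mfderiv_surjective_of_isSubmersion 𝒢.isSubmersion_s g w
    rw [𝒢.normalRep_mk, Submodule.Quotient.eq] at hvw
    -- The error `v - dt u` is tangent to the orbit, so it equals `dt u'` for some `u'` in `ker d_g
    -- s`. Adding `u'` corrects the target component and leaves the source component unchanged.
    have h1 := 𝒢.orbitTangentSpace_le _ _ hvw
    rw [← 𝒢.orbitDirection_eq_one] at h1
    obtain ⟨u', hu', hu'v⟩ := h1
    refine ⟨u + u', (𝒢.mfderiv_anchor g (u + u')).trans (Prod.ext ?_ ?_)⟩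
    · have h2 : mfderiv 𝓘(ℝ, EG) 𝓘(ℝ, EM) 𝒢.t g u' =
        v - mfderiv 𝓘(ℝ, EG) 𝓘(ℝ, EM) 𝒢.t g u := hu'v
      change mfderiv 𝓘(ℝ, EG) 𝓘(ℝ, EM) 𝒢.t g (u + u') = v
      rw [map_add, h2, add_sub_cancel]
    · have h2 : mfderiv 𝓘(ℝ, EG) 𝓘(ℝ, EM) 𝒢.s g u' = 0 := hu'
      change mfderiv 𝓘(ℝ, EG) 𝓘(ℝ, EM) 𝒢.s g (u + u') = mfderiv 𝓘(ℝ, EG) 𝓘(ℝ, EM) 𝒢.s g u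
      rw [map_add, h2, add_zero]
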